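/- Let $l,r$ be integers with $3\le l\le r$. For $\epsilon\in[0,1]$ and $p\in[0,1]$ let \[ W_s(\epsilon,p)=\Big(1-\frac1r\Big)(1-p)^{\frac{r}{r-1}}-(1-p)+\frac1r-\frac{\epsilon}{l}\,p^{l} \] be the potential of the uncoupled $(l,r)$-regular ensemble on the binary erasure channel. Let $\epsilon=\epsilon_{\mathrm{MAP}}$ be the largest $\epsilon\in[0,1]$ for which $W_s(\epsilon,\cdot)\ge 0$ on $[0,1]$, and let $p_{\mathrm{MAP}}>0$ be the nontrivial (largest) zero of $W_s(\epsilon_{\mathrm{MAP}},\cdot)$ in $[0,1]$. Let $\mathcal S$ be the set of continuous functions $p:\mathbb R\to[0,\infty)$ with $\lim_{z\to-\infty}z\,p(z)=0$ and $\lim_{z\to+\infty}z\,(p(z)-p_{\mathrm{MAP}})=0$; let $\mathcal S'$ be the set of (weakly) increasing $p\in\mathcal S$, $\mathcal S''$ the set of strictly increasing $p\in\mathcal S$, and $\mathcal S''_0$ the set of $p\in\mathcal S''$ with $p(0)=p_{\mathrm{MAP}}/2$. Let \[ \mathcal W[p]=\int_{\mathbb R}\Big\{\Big(1-\frac1r\Big)(1-p(z))^{\frac{r}{r-1}}-(1-p(z))+\frac1r-\frac{\epsilon}{l}\Big(\int_0^1p(z+u)\,du\Big)^{l}\Big\}\,dz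 , \] where $\epsilon=\epsilon_{\mathrm{MAP}}$; the integrand is integrable for every $p\in\mathcal S'$. Then: 1. $\mathcal W$ has a unique minimizer $p_0$ over $\mathcal S''_0$, and the minimizers of $\mathcal W$ over $\mathcal S'$ are exactly the translates $p_0(\cdot-\tau)$, $\tau\in\mathbb R$. 2. The continuum density-evolution equation \[ 1-(1-p(z))^{\frac1{r-1}}=\epsilon\int_0^1\Big(\int_0^1p(z+u-v)\,du\Big)^{l-1}dv\qquad(z\in\mathbb R), \] with $\epsilon=\epsilon_{\mathrm{MAP}}$, has a unique solution $p_1$ in $\mathcal S''_0$, and its solutions in $\mathcal S'$ are exactly the translates $p_1(\cdot-\tau)$, $\tau\in\mathbb R$. -/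

import Mathlib

open MeasureTheory Filter Topology Set

noncomputable section

/-- The potential `W_s` of the uncoupled `(l,r)`-regular ensemble at erasure parameter `ε`,
as a function of the check-erasure probability `p`. -/
def singlePotential (l r : ℕ) (ε p : ℝ) : ℝ :=
  (1 - 1 / (r : ℝ)) * (1 - p) ^ ((r : ℝ) / ((r : ℝ) - 1)) - (1 - p) + 1 / (r : ℝ)
    - ε / (l : ℝ) * p ^ l

/-- The MAP threshold: the largest channel parameter at which the single-system potential is
still nonnegative on `[0,1]`. -/
def epsMAP (l r : ℕ) : ℝ :=
  sSup {ε : ℝ | ε ∈ Icc (0 : ℝ) 1 ∧ ∀ p ∈ Icc (0 : ℝ) 1, 0 ≤ singlePotential l r ε p}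

/-- The nontrivial zero of the single-system potential at the MAP threshold (it also vanishes
at `p = 0`, so this is the largest of its zeros). -/
def pMAP (l r : ℕ) : ℝ :=
  sSup {p : ℝ | p ∈ Icc (0 : ℝ) 1 ∧ singlePotential l r (epsMAP l r) p = 0}

/-- The integrand of the coupled potential functional at the position `z`. -/
def potentialDensity (l r : ℕ) (ε : ℝ) (p : ℝ → ℝ) (z : ℝ) : ℝ :=
  (1 - 1 / (r : ℝ)) * (1 - p z) ^ ((r : ℝ) / ((r : ℝ) - 1)) - (1 - p z) + 1 / (r : ℝ)
    - ε / (l : ℝ) * (∫ u in (0 : ℝ)..1, p (z + u)) ^ l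

/-- The coupled potential functional `W[p(·)]` in the continuum. -/
def potential (l r : ℕ) (ε : ℝ) (p : ℝ → ℝ) : ℝ :=
  ∫ z : ℝ, potentialDensity l r ε p z

/-- The continuum density-evolution equation, at every position `z`. -/
def IsDESolution (l r : ℕ) (ε : ℝ) (p : ℝ → ℝ) : Prop :=
  ∀ z : ℝ, 1 - (1 - p z) ^ (1 / ((r : ℝ) - 1)) =
    ε * ∫ v in (0 : ℝ)..1, (∫ u in (0 : ℝ)..1, p (z + u - v)) ^ (l - 1)

/-- The space `S` of continuous nonnegative profiles that tend to `0` at `-∞` and to `P` at `+∞`,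
faster than `1/|z|`. -/
def profiles (P : ℝ) : Set (ℝ → ℝ) :=
  {p | Continuous p ∧ (∀ z, 0 ≤ p z) ∧ Tendsto (fun z => z * p z) atBot (𝓝 0) ∧
    Tendsto (fun z => z * (p z - P)) atTop (𝓝 0)}

/-- The space `S'` of (weakly) increasing profiles. -/
def increasingProfiles (P : ℝ) : Set (ℝ → ℝ) :=
  {p | p ∈ profiles P ∧ Monotone p}

/-- The space `S''` of strictly increasing profiles. -/
def strictProfiles (P : ℝ) : Set (ℝ → ℝ) :=
  {p | p ∈ profiles P ∧ StrictMono p}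

/-- The space `S''₀` of strictly increasing profiles pinned at the origin. -/
def pinnedProfiles (P : ℝ) : Set (ℝ → ℝ) :=
  {p | p ∈ strictProfiles P ∧ p 0 = P / 2}

/-- `p` is a minimizer of the potential functional in the space `X`. -/
def IsMinimizerIn (l r : ℕ) (ε : ℝ) (X : Set (ℝ → ℝ)) (p : ℝ → ℝ) : Prop :=
  p ∈ X ∧ ∀ q ∈ X, potential l r ε p ≤ potential l r ε q

/-- `q` is a translate of `p`. -/
def IsTranslate (p q : ℝ → ℝ) : Prop :=
  ∃ τ : ℝ, ∀ z : ℝ, q z = p (z - τ)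

end

/-! Write $P=p_{\mathrm{MAP}}$ and let $T$ (`deOp`) be the density-evolution operator, so that the
density-evolution equation reads $Tp=p$. $T$ is order preserving and commutes with translations. The
two parts of the theorem concern the same profiles, $p_0=p_1$, because of three facts.

Descent (`integral_bregman_le`): $\mathcal W[p]-\mathcal W[Tp]$ is at least the integral over any
interval $[-M,M]$ of the Bregman divergence of the strictly convex check potential between $Tp$ and
$p$. Hence every minimizer over the increasing profiles is a fixed point.

Uniqueness (`exists_translate`): fixed points are compared by sliding one under the other. A first
contact spreads over the whole line by the strong comparison principle. No contact can occur first
at infinity, because $T$ is a contraction near both constant states. Near $0$ this is $l\ge3$; near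
$P$ it follows from the unimodality of $(1-w)/(1-w^{r-1})^{l-1}$, which also makes $W_s$ positive on
$(0,P)$.

Existence (`exists_minimizer`): applying $T$ to a minimizing sequence does not raise $\mathcal W$
and makes the sequence equi-Lipschitz. After pinning by translation, a subsequence converges
pointwise to a fixed point. Adding a term of constant integral turns $\mathcal W$ into the integral
of a density bounded below by $W_s(p(z))\ge0$. The limit therefore has finite energy, its values at
$\pm\infty$ are zeros of $W_s$, and the pinning leaves only $0$ and $P$. The contraction near these
states gives the required decay. -/

/-! ### Unimodality of $(1-w)/(1-w^n)^{m+1}$. -/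

/-- The sign of `A m n w = m n w^(n-1) (1-w) - (1-w^n)` is the sign of the derivative of
`(1-w) / (1-w^n)^m`. It changes at most once on `[0,1)`, from negative to positive. -/
theorem unimodal_numerator_pos {m n : ℕ} (hn : 2 ≤ n) {w w' : ℝ} (hw : 0 ≤ w)
    (hww' : w < w') (hw' : w' < 1)
    (h : 0 ≤ (m * n : ℝ) * w ^ (n - 1) * (1 - w) - (1 - w ^ n)) :
    0 < (m * n : ℝ) * w' ^ (n - 1) * (1 - w') - (1 - w' ^ n) := by
  have hgeom : ∀ x : ℝ, (1 - x ^ n) = (∑ i ∈ Finset.range n, x ^ i) * (1 - x) := fun x => by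
    have := geom_sum_mul x n
    linarith
  set c : ℝ := m * n
  have hS : ∀ x : ℝ, c * x ^ (n - 1) * (1 - x) - (1 - x ^ n)
      = (c * x ^ (n - 1) - ∑ i ∈ Finset.range n, x ^ i) * (1 - x) := fun x => by
    rw [hgeom]; ring
  rw [hS] at h ⊢
  have h1 : 0 ≤ c * w ^ (n - 1) - ∑ i ∈ Finset.range n, w ^ i :=
    nonneg_of_mul_nonneg_left h (by linarith)
  refine mul_pos ?_ (by linarith)
  have hS1 : 1 ≤ ∑ i ∈ Finset.range n, w ^ i := by
    have := Finset.single_le_sum (f := fun i => w ^ i) (s := Finset.range n)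
      (fun i _ => pow_nonneg hw i) (Finset.mem_range.2 (by omega : 0 < n))
    simpa using this
  have hw0 : 0 < w := by
    rcases hw.eq_or_lt with h0 | h0
    · rw [← h0, zero_pow (by omega)] at h1
      rw [← h0] at hS1
      linarith
    · exact h0
  -- With the factor $1-w$ removed, the sign is that of $c-\sum_{i<n}w^{i-(n-1)}$. This sum of
  -- nonpositive powers is strictly decreasing, the term $i=0$ being strict because $n\ge2$.
  have key : (∑ i ∈ Finset.range n, w' ^ i) * w ^ (n - 1)
      < (∑ i ∈ Finset.range n, w ^ i) * w' ^ (n - 1) := by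
    rw [Finset.sum_mul, Finset.sum_mul]
    have hsplit : ∀ (x y : ℝ) (i : ℕ), i ∈ Finset.range n →
        x ^ i * y ^ (n - 1) = (x * y) ^ i * y ^ (n - 1 - i) := fun x y i hi => by
      have : n - 1 = i + (n - 1 - i) := by have := Finset.mem_range.1 hi; omega
      rw [mul_pow, mul_assoc, ← pow_add, ← this]
    refine Finset.sum_lt_sum (fun i hi => ?_) ⟨0, Finset.mem_range.2 (by omega), ?_⟩
    · rw [hsplit _ _ i hi, hsplit _ _ i hi, mul_comm w' w]
      have := pow_le_pow_left₀ hw hww'.le (n - 1 - i)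
      have hp : 0 ≤ (w * w') ^ i := pow_nonneg (mul_nonneg hw (hw.trans hww'.le)) i
      exact mul_le_mul_of_nonneg_left this hp
    · simpa using pow_lt_pow_left₀ hww' hw (by omega : n - 1 ≠ 0)
  have hp : 0 < w ^ (n - 1) := by positivity
  have hp' : 0 < w' ^ (n - 1) := by have := hw0.trans hww'; positivity
  have h2 : (∑ i ∈ Finset.range n, w ^ i) * w' ^ (n - 1) ≤ c * w ^ (n - 1) * w' ^ (n - 1) :=
    mul_le_mul_of_nonneg_right (by linarith) hp'.le
  have h3 : (∑ i ∈ Finset.range n, w' ^ i) * w ^ (n - 1) < (c * w' ^ (n - 1)) * w ^ (n - 1) := by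
    calc _ < _ := key
      _ ≤ _ := h2
      _ = _ := by ring
  linarith [lt_of_mul_lt_mul_right h3 hp.le]

theorem hasDerivAt_unimodal {m n : ℕ} (hn : 2 ≤ n) {w : ℝ} (hw0 : 0 ≤ w) (hw : w < 1) :
    HasDerivAt (fun w : ℝ => (1 - w) / (1 - w ^ n) ^ (m + 1))
      ((((m + 1 : ℕ) * n : ℝ) * w ^ (n - 1) * (1 - w) - (1 - w ^ n)) / (1 - w ^ n) ^ (m + 2)) w := by
  have hpos : 0 < 1 - w ^ n := by
    have := pow_lt_one₀ hw0 hw (by omega : n ≠ 0)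
    linarith
  have h1 : HasDerivAt (fun w : ℝ => 1 - w) (-1) w := by
    simpa using (hasDerivAt_id w).const_sub 1
  have h2 : HasDerivAt (fun w : ℝ => 1 - w ^ n) (-(n * w ^ (n - 1))) w := by
    simpa using (hasDerivAt_pow n w).const_sub 1
  have h3 := h1.fun_div (h2.fun_pow (m + 1)) (pow_pos hpos _).ne'
  refine h3.congr_deriv ?_
  simp only [Nat.add_sub_cancel]
  field_simp
  push_cast
  ring

theorem unimodal_strictMonoOn {m n : ℕ} (hn : 2 ≤ n) {w : ℝ} (hw : 0 ≤ w)
    (h : 0 ≤ ((m + 1 : ℕ) * n : ℝ) * w ^ (n - 1) * (1 - w) - (1 - w ^ n)) :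
    StrictMonoOn (fun w : ℝ => (1 - w) / (1 - w ^ n) ^ (m + 1)) (Ico w 1) := by
  refine strictMonoOn_of_deriv_pos (convex_Ico _ _) (fun x hx =>
    (hasDerivAt_unimodal hn (hw.trans hx.1) hx.2).continuousAt.continuousWithinAt) fun x hx => ?_
  rw [interior_Ico] at hx
  rw [(hasDerivAt_unimodal hn (hw.trans hx.1.le) hx.2).deriv]
  have hpos : 0 < 1 - x ^ n := by
    have := pow_lt_one₀ (hw.trans hx.1.le) hx.2 (by omega : n ≠ 0)
    linarith
  exact div_pos (unimodal_numerator_pos hn hw hx.1 hx.2 h) (by positivity)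

theorem unimodal_strictAntiOn {m n : ℕ} (hn : 2 ≤ n) {w w' : ℝ} (hw : 0 ≤ w) (hw' : w' < 1)
    (h : ((m + 1 : ℕ) * n : ℝ) * w' ^ (n - 1) * (1 - w') - (1 - w' ^ n) ≤ 0) :
    StrictAntiOn (fun w : ℝ => (1 - w) / (1 - w ^ n) ^ (m + 1)) (Icc w w') := by
  refine strictAntiOn_of_deriv_neg (convex_Icc _ _) (fun x hx =>
    (hasDerivAt_unimodal hn (hw.trans hx.1) (hx.2.trans_lt hw')).continuousAt.continuousWithinAt)
    fun x hx => ?_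
  rw [interior_Icc] at hx
  rw [(hasDerivAt_unimodal hn (hw.trans hx.1.le) (hx.2.trans hw')).deriv]
  have hpos : 0 < 1 - x ^ n := by
    have := pow_lt_one₀ (hw.trans hx.1.le) (hx.2.trans hw') (by omega : n ≠ 0)
    linarith
  refine div_neg_of_neg_of_pos ?_ (by positivity)
  by_contra! hc
  linarith [unimodal_numerator_pos hn (hw.trans hx.1.le) hx.2 hw' hc]

/-! ### The check-node potential, its derivative and its Bregman divergence -/

noncomputable section

/-- The part of the potential that belongs to the check nodes. -/
def checkPotential (r : ℕ) (p : ℝ) : ℝ :=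
  (1 - 1 / (r : ℝ)) * (1 - p) ^ ((r : ℝ) / ((r : ℝ) - 1)) - (1 - p) + 1 / (r : ℝ)

/-- The derivative of `checkPotential`. -/
def checkInv (r : ℕ) (p : ℝ) : ℝ := 1 - (1 - p) ^ (1 / ((r : ℝ) - 1))

/-- The Bregman divergence of `checkPotential`. -/
def bregman (r : ℕ) (a b : ℝ) : ℝ :=
  checkPotential r b - checkPotential r a - checkInv r a * (b - a)

end

theorem singlePotential_eq (l r : ℕ) (ε p : ℝ) :
    singlePotential l r ε p = checkPotential r p - ε / l * p ^ l := rfl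

section Check

variable {r : ℕ}

theorem checkInv_exponent_pos (hr : 3 ≤ r) : 0 < 1 / ((r : ℝ) - 1) := by
  have : (3 : ℝ) ≤ r := by exact_mod_cast hr
  apply one_div_pos.2; linarith

theorem checkInv_exponent_lt_one (hr : 3 ≤ r) : 1 / ((r : ℝ) - 1) < 1 := by
  have : (3 : ℝ) ≤ r := by exact_mod_cast hr
  rw [div_lt_one (by linarith)]; linarith

/-- The exponent $r/(r-1)$ is at least $1$, so differentiability survives at $p=1$, where the base
vanishes. -/
theorem hasDerivAt_checkPotential (hr : 3 ≤ r) (p : ℝ) :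
    HasDerivAt (checkPotential r) (checkInv r p) p := by
  have h3 : (3 : ℝ) ≤ r := by exact_mod_cast hr
  have h1 : HasDerivAt (fun p : ℝ => 1 - p) (-1) p := by
    simpa using (hasDerivAt_id p).const_sub 1
  have hexp : (1 : ℝ) ≤ (r : ℝ) / ((r : ℝ) - 1) := by
    rw [le_div_iff₀ (by linarith)]; linarith
  have h2 := h1.rpow_const (p := (r : ℝ) / ((r : ℝ) - 1)) (Or.inr hexp)
  have h4 := ((h2.const_mul (1 - 1 / (r : ℝ))).fun_sub h1).add_const (1 / (r : ℝ))
  have he : (r : ℝ) / ((r : ℝ) - 1) - 1 = 1 / ((r : ℝ) - 1) := by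
    field_simp [show (r : ℝ) - 1 ≠ 0 by linarith]; ring
  refine h4.congr_deriv ?_
  rw [he, checkInv]
  field_simp [show (r : ℝ) - 1 ≠ 0 by linarith]
  ring

theorem continuous_checkPotential (hr : 3 ≤ r) : Continuous (checkPotential r) :=
  continuous_iff_continuousAt.2 fun p => (hasDerivAt_checkPotential hr p).continuousAt

theorem continuous_checkInv (hr : 3 ≤ r) : Continuous (checkInv r) := by
  unfold checkInv
  exact continuous_const.sub ((continuous_const.sub continuous_id).rpow_const
    fun _ => Or.inr (checkInv_exponent_pos hr).le)

theorem checkInv_strictMonoOn (hr : 3 ≤ r) : StrictMonoOn (checkInv r) (Iic 1) := by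
  intro a ha b hb hab
  have := Real.rpow_lt_rpow (sub_nonneg.2 hb) (by linarith : 1 - b < 1 - a)
    (checkInv_exponent_pos hr)
  unfold checkInv
  linarith

theorem checkPotential_strictConvexOn (hr : 3 ≤ r) :
    StrictConvexOn ℝ (Iic 1) (checkPotential r) := by
  refine StrictMonoOn.strictConvexOn_of_deriv (convex_Iic 1)
    (continuous_checkPotential hr).continuousOn ?_
  have : deriv (checkPotential r) = checkInv r :=
    funext fun p => (hasDerivAt_checkPotential hr p).deriv
  rw [this]
  exact (checkInv_strictMonoOn hr).mono interior_subset

theorem bregman_pos (hr : 3 ≤ r) {a b : ℝ} (ha : a ≤ 1) (hb : b ≤ 1) (hab : a ≠ b) :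
    0 < bregman r a b := by
  unfold bregman
  rcases lt_or_gt_of_ne hab with h | h
  · have := (checkPotential_strictConvexOn hr).lt_slope_of_hasDerivAt ha hb h
      (hasDerivAt_checkPotential hr a)
    rw [slope_def_field, lt_div_iff₀ (by linarith)] at this
    linarith
  · have := (checkPotential_strictConvexOn hr).slope_lt_of_hasDerivAt hb ha h
      (hasDerivAt_checkPotential hr a)
    rw [slope_def_field, div_lt_iff₀ (by linarith)] at this
    linarith

theorem bregman_nonneg (hr : 3 ≤ r) {a b : ℝ} (ha : a ≤ 1) (hb : b ≤ 1) :
    0 ≤ bregman r a b := by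
  rcases eq_or_ne a b with h | h
  · simp [bregman, h]
  · exact (bregman_pos hr ha hb h).le

theorem continuous_bregman (hr : 3 ≤ r) : Continuous fun x : ℝ × ℝ => bregman r x.1 x.2 := by
  have h1 := continuous_checkPotential hr
  have h2 := continuous_checkInv hr
  unfold bregman
  fun_prop

theorem checkInv_zero : checkInv r 0 = 0 := by simp [checkInv]

theorem checkPotential_zero : checkPotential r 0 = 0 := by
  simp [checkPotential]

theorem checkInv_one (hr : 3 ≤ r) : checkInv r 1 = 1 := by
  rw [checkInv, sub_self, Real.zero_rpow (checkInv_exponent_pos hr).ne', sub_zero]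

/-- The potential and its derivative vanish at $0$, so its value at $p$ is the Bregman divergence
from $0$ to $p$. -/
theorem checkPotential_pos (hr : 3 ≤ r) {p : ℝ} (hp : 0 < p) (hp1 : p ≤ 1) :
    0 < checkPotential r p := by
  have := bregman_pos hr zero_le_one hp1 hp.ne
  simpa [bregman, checkInv_zero, checkPotential_zero] using this

theorem rpow_inv_pred_pow (hr : 3 ≤ r) {x : ℝ} (hx : 0 ≤ x) :
    (x ^ (1 / ((r : ℝ) - 1))) ^ (r - 1) = x := by
  have : ((r : ℝ) - 1) = ((r - 1 : ℕ) : ℝ) := by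
    rw [Nat.cast_sub (by omega)]; simp
  rw [this, one_div, Real.rpow_inv_natCast_pow hx (by omega)]

theorem pow_pred_rpow_inv (hr : 3 ≤ r) {x : ℝ} (hx : 0 ≤ x) :
    (x ^ (r - 1)) ^ (1 / ((r : ℝ) - 1)) = x := by
  have : ((r : ℝ) - 1) = ((r - 1 : ℕ) : ℝ) := by
    rw [Nat.cast_sub (by omega)]; simp
  rw [this, one_div, Real.pow_rpow_inv_natCast hx (by omega)]

/-- This converts the density-evolution equation into the fixed-point form $p=Tp$; the bounds keep
both bases nonnegative. -/
theorem checkInv_eq_iff (hr : 3 ≤ r) {p y : ℝ} (hp : p ≤ 1) (hy : y ≤ 1) :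
    checkInv r p = y ↔ p = 1 - (1 - y) ^ (r - 1) := by
  unfold checkInv
  constructor
  · rintro rfl
    rw [sub_sub_cancel, rpow_inv_pred_pow hr (by linarith), sub_sub_cancel]
  · rintro rfl
    rw [sub_sub_cancel, pow_pred_rpow_inv hr (by linarith), sub_sub_cancel]

/-- Subadditivity of $t\mapsto t^\beta$. It gives Hölder continuity of `checkInv` up to $p=1$, where
no Lipschitz bound holds. -/
theorem abs_rpow_sub_rpow_le {x y β : ℝ} (hx : 0 ≤ x) (hy : 0 ≤ y) (h0 : 0 ≤ β) (h1 : β ≤ 1) :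
    |x ^ β - y ^ β| ≤ |x - y| ^ β := by
  wlog hxy : y ≤ x generalizing x y
  · rw [abs_sub_comm, abs_sub_comm x y]
    exact this hy hx (by linarith)
  rw [abs_of_nonneg (sub_nonneg.2 (Real.rpow_le_rpow hy hxy h0)), abs_of_nonneg (by linarith)]
  have := Real.rpow_add_le_add_rpow (sub_nonneg.2 hxy) hy h0 h1
  rw [sub_add_cancel] at this
  linarith

theorem abs_pow_succ_sub_pow_succ_le {x y b : ℝ} (hx : 0 ≤ x) (hy : 0 ≤ y) (hxb : x ≤ b) (hyb : y ≤ b)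
    (n : ℕ) : |x ^ (n + 1) - y ^ (n + 1)| ≤ (n + 1) * b ^ n * |x - y| := by
  have h := abs_pow_sub_pow_le x y (n + 1)
  rw [abs_of_nonneg hx, abs_of_nonneg hy, Nat.add_sub_cancel] at h
  have hm : max x y ^ n ≤ b ^ n := pow_le_pow_left₀ (le_max_of_le_left hx) (max_le hxb hyb) n
  calc _ ≤ _ := h
    _ ≤ |x - y| * (n + 1 : ℕ) * b ^ n := mul_le_mul_of_nonneg_left hm (by positivity)
    _ = _ := by push_cast; ring

end Check

/-! ### Nontrivial zeros of the single-system potential -/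

/-- `P` is a nontrivial zero and critical point of the single-system potential, which is
nonnegative. -/
structure IsCritical (l r : ℕ) (ε P : ℝ) : Prop where
  three_le : 3 ≤ l
  le : l ≤ r
  eps_pos : 0 < ε
  eps_le : ε ≤ 1
  pos : 0 < P
  le_one : P ≤ 1
  nonneg : ∀ p ∈ Icc (0 : ℝ) 1, 0 ≤ singlePotential l r ε p
  zero : singlePotential l r ε P = 0
  crit : checkInv r P = ε * P ^ (l - 1)

theorem hasDerivAt_singlePotential {l r : ℕ} (hl : 3 ≤ l) (hr : 3 ≤ r) (ε p : ℝ) :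
    HasDerivAt (singlePotential l r ε) (checkInv r p - ε * p ^ (l - 1)) p := by
  have h := (hasDerivAt_checkPotential hr p).fun_sub ((hasDerivAt_pow l p).const_mul (ε / l))
  refine h.congr_deriv ?_
  have : (l : ℝ) ≠ 0 := by positivity
  field_simp

theorem continuous_singlePotential {l r : ℕ} (hl : 3 ≤ l) (hr : 3 ≤ r) (ε : ℝ) :
    Continuous (singlePotential l r ε) :=
  continuous_iff_continuousAt.2 fun p => (hasDerivAt_singlePotential hl hr ε p).continuousAt

theorem isCritical_of_zero {l r : ℕ} {ε P : ℝ} (hl : 3 ≤ l) (hlr : l ≤ r) (hε : ε ≤ 1)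
    (hP : 0 < P) (hP1 : P ≤ 1)
    (hn : ∀ p ∈ Icc (0 : ℝ) 1, 0 ≤ singlePotential l r ε p)
    (hz : singlePotential l r ε P = 0) : IsCritical l r ε P := by
  have hr : 3 ≤ r := hl.trans hlr
  have hd := hasDerivAt_singlePotential hl hr ε P
  have hl0 : (0 : ℝ) < l := by positivity
  have hε0 : 0 < ε := by
    have h1 := checkPotential_pos hr hP hP1
    rw [singlePotential_eq] at hz
    have : 0 < ε * (P ^ l / l) := by
      have : ε * (P ^ l / l) = ε / l * P ^ l := by ring
      linarith
    exact pos_of_mul_pos_left this (by positivity)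
  refine ⟨hl, hlr, hε0, hε, hP, hP1, hn, hz, ?_⟩
  -- At the endpoint $P=1$ minimality only gives a nonpositive derivative, that is
  -- $1-\varepsilon\le0$; together with $\varepsilon\le1$ this is equality.
  rcases hP1.eq_or_lt with h1 | h1
  · have hle : checkInv r P - ε * P ^ (l - 1) ≤ 0 := by
      by_contra! hc
      have hs := hasDerivAt_iff_tendsto_slope.1 hd
      have hev : ∀ᶠ x in 𝓝[<] P, 0 < slope (singlePotential l r ε) P x :=
        (hs.mono_left (nhdsWithin_mono _ (fun x hx => ne_of_lt hx))).eventually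
          (lt_mem_nhds hc)
      obtain ⟨x, hx, hx0, hxP⟩ := (hev.and ((Ioo_mem_nhdsLT hP : Ioo 0 P ∈ _))).exists
      rw [slope_def_field, hz] at hx
      have := hn x ⟨hx0.le, hxP.le.trans hP1⟩
      have h2 : (singlePotential l r ε x - 0) / (x - P) ≤ 0 :=
        div_nonpos_of_nonneg_of_nonpos (by linarith) (by linarith)
      linarith
    rw [h1, checkInv_one hr, one_pow] at hle ⊢
    linarith
  · have hmin : IsLocalMin (singlePotential l r ε) P := by
      filter_upwards [Icc_mem_nhds hP h1] with x hx
      rw [hz]; exact hn x hx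
    linarith [hmin.hasDerivAt_eq_zero hd]

namespace IsCritical

variable {l r : ℕ} {ε P : ℝ}

theorem three_le_right (h : IsCritical l r ε P) : 3 ≤ r := h.three_le.trans h.le

/-- The substitution $p=1-w^{r-1}$ removes the fractional powers. In terms of $w$, $W_s'(p)$ has the
sign of $(1-w)/(1-w^{r-1})^{l-1}-\varepsilon$ for $p>0$. -/
theorem exists_root (hr : 3 ≤ r) {p : ℝ} (hp : 0 ≤ p) (hp1 : p ≤ 1) :
    ∃ w : ℝ, 0 ≤ w ∧ w ≤ 1 ∧ 1 - w ^ (r - 1) = p ∧ checkInv r p = 1 - w := by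
  refine ⟨(1 - p) ^ (1 / ((r : ℝ) - 1)), Real.rpow_nonneg (by linarith) _,
    Real.rpow_le_one (by linarith) (by linarith) (checkInv_exponent_pos hr).le, ?_, rfl⟩
  rw [rpow_inv_pred_pow hr (by linarith)]; ring

/-- Criticality says that $\psi(w)=(1-w)/(1-w^{r-1})^{l-1}$ equals $\varepsilon$ at the root of $P$.
Were $\psi'\ge0$ there, unimodality would give $\psi>\varepsilon$ from there up to $1$, hence
$W_s'>0$ on $(0,P)$, contradicting $W_s(0)=W_s(P)=0$. -/
theorem numerator_neg (h : IsCritical l r ε P) {w : ℝ} (hw : 0 ≤ w) (hw1 : w < 1)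
    (hwP : 1 - w ^ (r - 1) = P) :
    ((l - 1 : ℕ) * (r - 1 : ℕ) : ℝ) * w ^ (r - 1 - 1) * (1 - w) - (1 - w ^ (r - 1)) < 0 := by
  have hr := h.three_le_right
  by_contra! hc
  obtain ⟨m, hm⟩ : ∃ m, l - 1 = m + 1 := ⟨l - 2, by have := h.three_le; omega⟩
  rw [hm] at hc
  have hmono := unimodal_strictMonoOn (by omega : 2 ≤ r - 1) hw hc
  have hvalue : (1 - w) / (1 - w ^ (r - 1)) ^ (m + 1) = ε := by
    have hcr := h.crit
    rw [hm, checkInv_eq_iff hr h.le_one] at hcr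
    · rw [hwP]
      have hPp := h.pos
      have : w = 1 - ε * P ^ (m + 1) := by
        have h1 : w ^ (r - 1) = (1 - ε * P ^ (m + 1)) ^ (r - 1) := by linarith
        have hle : ε * P ^ (m + 1) ≤ 1 := mul_le_one₀ h.eps_le (by positivity)
          (pow_le_one₀ hPp.le h.le_one)
        exact (pow_left_inj₀ hw (by linarith) (by omega)).1 h1
      rw [this]; field_simp; ring
    · exact mul_le_one₀ h.eps_le (pow_nonneg h.pos.le _) (pow_le_one₀ h.pos.le h.le_one)
  have hsm : StrictMonoOn (singlePotential l r ε) (Icc 0 P) := by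
    refine strictMonoOn_of_deriv_pos (convex_Icc _ _)
      (continuous_singlePotential h.three_le hr ε).continuousOn fun x hx => ?_
    rw [interior_Icc] at hx
    rw [(hasDerivAt_singlePotential h.three_le hr ε x).deriv]
    obtain ⟨v, hv0, hv1, hvx, hvc⟩ := exists_root hr hx.1.le (hx.2.le.trans h.le_one)
    have hvlt : v < 1 := by
      rcases hv1.eq_or_lt with e | e
      · rw [e, one_pow] at hvx; linarith [hx.1]
      · exact e
    have hwv : w < v := by
      refine lt_of_pow_lt_pow_left₀ (r - 1) hv0 ?_
      linarith [hx.2]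
    have := hmono ⟨le_rfl, hw1⟩ ⟨hwv.le, hvlt⟩ hwv
    simp only at this
    rw [hvalue, hvx, lt_div_iff₀ (pow_pos hx.1 _)] at this
    rw [hvc, hm]; linarith
  have := hsm ⟨le_rfl, h.pos.le⟩ ⟨h.pos.le, le_rfl⟩ h.pos
  rw [h.zero, singlePotential_eq, checkPotential_zero, zero_pow (by have := h.three_le; omega)]
    at this
  simp at this

theorem root_lt_one (h : IsCritical l r ε P) {w : ℝ} (hw1 : w ≤ 1)
    (hwP : 1 - w ^ (r - 1) = P) : w < 1 := by
  rcases hw1.eq_or_lt with e | e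
  · rw [e, one_pow] at hwP; linarith [h.pos]
  · exact e

/-- Both roots give $\psi=\varepsilon$. The numerator is negative at the larger root, which belongs
to $Q$, so $\psi$ is strictly decreasing between the two and they must coincide. -/
theorem eq_of_le {Q : ℝ} (h : IsCritical l r ε P) (h' : IsCritical l r ε Q) (hQ : Q ≤ P) :
    Q = P := by
  have hr := h.three_le_right
  obtain ⟨w, hw0, hw1, hwP, hwc⟩ := exists_root hr h.pos.le h.le_one
  obtain ⟨v, hv0, hv1, hvQ, hvc⟩ := exists_root hr h'.pos.le h'.le_one
  by_contra hne
  have hwv : w < v := by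
    refine lt_of_pow_lt_pow_left₀ (r - 1) hv0 ?_
    have := lt_of_le_of_ne hQ hne
    linarith
  have hvlt := h'.root_lt_one hv1 hvQ
  have hneg := (h'.numerator_neg hv0 hvlt hvQ).le
  obtain ⟨m, hm⟩ : ∃ m, l - 1 = m + 1 := ⟨l - 2, by have := h.three_le; omega⟩
  rw [hm] at hneg
  have := unimodal_strictAntiOn (by omega : 2 ≤ r - 1) hw0 hvlt hneg ⟨le_rfl, hwv.le⟩
    ⟨hwv.le, le_rfl⟩ hwv
  simp only at this
  rw [hwP, hvQ, ← hwc, ← hvc, h.crit, h'.crit, hm,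
    mul_div_cancel_right₀ _ (pow_pos h.pos _).ne',
    mul_div_cancel_right₀ _ (pow_pos h'.pos _).ne'] at this
  exact lt_irrefl _ this

theorem singlePotential_pos (h : IsCritical l r ε P) {p : ℝ} (hp : 0 < p) (hpP : p < P) :
    0 < singlePotential l r ε p := by
  have hp1 : p ≤ 1 := hpP.le.trans h.le_one
  refine lt_of_le_of_ne (h.nonneg p ⟨hp.le, hp1⟩) fun h0 => ?_
  have := h.eq_of_le (isCritical_of_zero h.three_le h.le h.eps_le hp hp1 h.nonneg h0.symm) hpP.le
  exact hpP.ne this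

end IsCritical

/-! ### Hölder bounds on the potential and contraction near the constant states -/

noncomputable section

/-- The Lipschitz constant of the uncoupled density-evolution map between the values
`a` and `b`. -/
def contractionRate (l r : ℕ) (ε a b : ℝ) : ℝ :=
  ((r - 1 : ℕ) : ℝ) * (1 - ε * a ^ (l - 1)) ^ (r - 2) * (ε * (((l - 1 : ℕ) : ℝ) * b ^ (l - 2)))

end

/-- The check part is Hölder with constant $1$ and the polynomial part Lipschitz with constant
$l-1$. Since $|x-y|\le1$, both fit under the exponent $1/(r-1)<1$. -/
theorem abs_singlePotential_deriv_sub_le {l r : ℕ} {ε x y : ℝ} (hl : 3 ≤ l) (hr : 3 ≤ r)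
    (hε : 0 ≤ ε) (hε1 : ε ≤ 1) (hx : x ∈ Icc (0 : ℝ) 1) (hy : y ∈ Icc (0 : ℝ) 1) :
    |(checkInv r x - ε * x ^ (l - 1)) - (checkInv r y - ε * y ^ (l - 1))|
      ≤ l * |x - y| ^ (1 / ((r : ℝ) - 1)) := by
  obtain ⟨n, rfl⟩ : ∃ n, l = n + 2 := ⟨l - 2, by omega⟩
  simp only [show n + 2 - 1 = n + 1 by omega]
  set β := 1 / ((r : ℝ) - 1)
  have h1 := abs_rpow_sub_rpow_le (β := β) (sub_nonneg.2 hy.2) (sub_nonneg.2 hx.2)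
    (checkInv_exponent_pos hr).le (checkInv_exponent_lt_one hr).le
  rw [show 1 - y - (1 - x) = x - y by ring] at h1
  have h2 := abs_pow_succ_sub_pow_succ_le hx.1 hy.1 hx.2 hy.2 n
  rw [one_pow, mul_one] at h2
  have hd : |x - y| ≤ 1 := abs_le.2 ⟨by linarith [hx.1, hy.2], by linarith [hx.2, hy.1]⟩
  have h3 : |x - y| ≤ |x - y| ^ β := by
    rcases (abs_nonneg (x - y)).eq_or_lt with h0 | h0
    · rw [← h0]; positivity
    · have := Real.rpow_le_rpow_of_exponent_ge h0 hd (checkInv_exponent_lt_one hr).le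
      rwa [Real.rpow_one] at this
  have h4 : |ε * (y ^ (n + 1) - x ^ (n + 1))| ≤ (n + 1) * |x - y| := by
    rw [abs_mul, abs_of_nonneg hε, abs_sub_comm]
    calc ε * |x ^ (n + 1) - y ^ (n + 1)| ≤ 1 * ((n + 1) * |x - y|) := by gcongr
      _ = _ := one_mul _
  calc _ = |((1 - y) ^ β - (1 - x) ^ β) + ε * (y ^ (n + 1) - x ^ (n + 1))| := by
        simp only [checkInv]; congr 1; ring
    _ ≤ |x - y| ^ β + (n + 1) * |x - y| := (abs_add_le _ _).trans (add_le_add h1 h4)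
    _ ≤ |x - y| ^ β + (n + 1) * |x - y| ^ β := by gcongr
    _ = _ := by push_cast; ring

/-- A bound of order $1+\beta$ with $\beta>0$ is what makes $W_s(p(z))$ integrable for profiles that
approach their limits only like $o(1/|z|)$. -/
theorem singlePotential_le_of_crit {l r : ℕ} {ε c p : ℝ} (hl : 3 ≤ l) (hr : 3 ≤ r)
    (hε : 0 ≤ ε) (hε1 : ε ≤ 1) (hc : c ∈ Icc (0 : ℝ) 1) (hp : p ∈ Icc (0 : ℝ) 1)
    (hz : singlePotential l r ε c = 0) (hcrit : checkInv r c - ε * c ^ (l - 1) = 0) :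
    |singlePotential l r ε p| ≤ l * |p - c| ^ (1 / ((r : ℝ) - 1)) * |p - c| := by
  have h := (convex_uIcc c p).norm_image_sub_le_of_norm_hasDerivWithin_le
    (f := singlePotential l r ε) (f' := fun x => checkInv r x - ε * x ^ (l - 1))
    (C := l * |p - c| ^ (1 / ((r : ℝ) - 1))) (x := c) (y := p)
    (fun x _ => (hasDerivAt_singlePotential hl hr ε x).hasDerivWithinAt) ?_
    left_mem_uIcc right_mem_uIcc
  · simpa [hz] using h
  · intro x hx
    have hx1 : x ∈ Icc (0 : ℝ) 1 := uIcc_subset_Icc hc hp hx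
    have h1 := abs_singlePotential_deriv_sub_le hl hr hε hε1 hx1 hc
    rw [hcrit, sub_zero] at h1
    refine h1.trans ?_
    have h2 : |x - c| ≤ |p - c| := abs_sub_left_of_mem_uIcc hx
    gcongr
    exact (checkInv_exponent_pos hr).le

namespace IsCritical

variable {l r : ℕ} {ε P : ℝ}

theorem singlePotential_le_zero (h : IsCritical l r ε P) {p : ℝ} (hp : p ∈ Icc (0 : ℝ) 1) :
    |singlePotential l r ε p| ≤ l * |p| ^ (1 / ((r : ℝ) - 1)) * |p| := by
  have hr := h.three_le_right
  have hl := h.three_le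
  have := singlePotential_le_of_crit hl hr h.eps_pos.le h.eps_le ⟨le_rfl, zero_le_one⟩ hp
    (by rw [singlePotential_eq, checkPotential_zero, zero_pow (by omega)]; simp)
    (by rw [checkInv_zero, zero_pow (by omega)]; simp)
  simpa using this

theorem singlePotential_le_right (h : IsCritical l r ε P) {p : ℝ} (hp : p ∈ Icc (0 : ℝ) 1) :
    |singlePotential l r ε p| ≤ l * |p - P| ^ (1 / ((r : ℝ) - 1)) * |p - P| :=
  singlePotential_le_of_crit h.three_le h.three_le_right h.eps_pos.le h.eps_le
    ⟨h.pos.le, h.le_one⟩ hp h.zero (sub_eq_zero.2 h.crit)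

theorem eps_mul_pow_le (h : IsCritical l r ε P) {x : ℝ} (hx : 0 ≤ x) (hx1 : x ≤ P) (n : ℕ) :
    ε * x ^ n ≤ 1 :=
  mul_le_one₀ h.eps_le (pow_nonneg hx _) (pow_le_one₀ hx (hx1.trans h.le_one))

theorem fixed (h : IsCritical l r ε P) : 1 - (1 - ε * P ^ (l - 1)) ^ (r - 1) = P := by
  have := h.crit
  rw [checkInv_eq_iff h.three_le_right h.le_one (h.eps_mul_pow_le h.pos.le le_rfl _)] at this
  exact this.symm

/-- With $1-w=\varepsilon P^{l-1}$, the rate times $P$ is $(l-1)(r-1)w^{r-2}(1-w)$, and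
`numerator_neg` says that this is below $1-w^{r-1}=P$. -/
theorem contractionRate_lt_one (h : IsCritical l r ε P) : contractionRate l r ε P P < 1 := by
  have hr := h.three_le_right
  have hl := h.three_le
  have hP := h.pos
  have hy := h.eps_mul_pow_le h.pos.le le_rfl (l - 1)
  have hw1 : 1 - ε * P ^ (l - 1) < 1 := by
    have : 0 < ε * P ^ (l - 1) := mul_pos h.eps_pos (pow_pos hP _)
    linarith
  have hf := h.fixed
  have := h.numerator_neg (sub_nonneg.2 hy) hw1 hf
  rw [hf, show r - 1 - 1 = r - 2 by omega] at this
  have hlt : contractionRate l r ε P P * P < 1 * P := by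
    unfold contractionRate
    have hpow : P ^ (l - 1) = P ^ (l - 2) * P := by
      rw [← pow_succ]; congr 1; omega
    have e : ((r - 1 : ℕ) : ℝ) * (1 - ε * P ^ (l - 1)) ^ (r - 2)
        * (ε * (((l - 1 : ℕ) : ℝ) * P ^ (l - 2))) * P
      = ((l - 1 : ℕ) * (r - 1 : ℕ) : ℝ) * (1 - ε * P ^ (l - 1)) ^ (r - 2)
        * (1 - (1 - ε * P ^ (l - 1))) := by
      rw [sub_sub_cancel]
      nth_rewrite 3 [hpow]
      ring
    rw [e]; linarith
  exact lt_of_mul_lt_mul_right hlt hP.le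

theorem contractionRate_nonneg (h : IsCritical l r ε P) {a b : ℝ} (ha : 0 ≤ a) (hb : 0 ≤ b)
    (haP : a ≤ P) : 0 ≤ contractionRate l r ε a b := by
  have := h.eps_mul_pow_le ha haP (l - 1)
  have h1 : 0 ≤ 1 - ε * a ^ (l - 1) := by linarith
  have := h.eps_pos
  unfold contractionRate
  positivity

/-- Near both constant solutions the density-evolution map is a contraction. -/
theorem exists_contraction (h : IsCritical l r ε P) :
    ∃ η κ : ℝ, 0 < η ∧ η < P ∧ 0 ≤ κ ∧ κ < 1 ∧ contractionRate l r ε 0 η ≤ κ ∧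
      contractionRate l r ε (P - η) P ≤ κ := by
  have hl := h.three_le
  have hP := h.pos
  have c1 : ContinuousAt (fun η => contractionRate l r ε 0 η) 0 := by
    unfold contractionRate; fun_prop
  have c2 : ContinuousAt (fun η => contractionRate l r ε (P - η) P) 0 := by
    unfold contractionRate; fun_prop
  -- At $\eta=0$ the two rates are $0$, since $l\ge3$, and a number below $1$; continuity preserves
  -- both bounds for small $\eta$.
  have h1 : contractionRate l r ε 0 0 < 1 := by
    rw [contractionRate, zero_pow (by omega : l - 2 ≠ 0)]; simp
  have h2 : contractionRate l r ε (P - 0) P < 1 := by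
    rw [sub_zero]; exact h.contractionRate_lt_one
  have e1 := c1.eventually (gt_mem_nhds h1)
  have e2 := c2.eventually (gt_mem_nhds h2)
  have e3 : ∀ᶠ η : ℝ in 𝓝 0, η < P := gt_mem_nhds hP
  obtain ⟨η, ⟨⟨⟨ha, hb⟩, hc⟩, hη⟩⟩ :=
    ((((e1.and e2).and e3).filter_mono nhdsWithin_le_nhds).and
      (self_mem_nhdsWithin : Ioi (0 : ℝ) ∈ 𝓝[>] 0)).exists
  have hη : 0 < η := hη
  exact ⟨η, max (contractionRate l r ε 0 η) (contractionRate l r ε (P - η) P), hη, hc,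
    le_max_of_le_left (h.contractionRate_nonneg le_rfl hη.le hP.le), max_lt ha hb,
    le_max_left _ _, le_max_right _ _⟩

end IsCritical

/-! ### The MAP threshold and its nontrivial zero -/

section MAP

variable {l r : ℕ}

theorem singlePotential_zero_eps (p : ℝ) : singlePotential l r 0 p = checkPotential r p := by
  simp [singlePotential_eq]

theorem mapSet_isCompact (l r : ℕ) :
    IsCompact {ε : ℝ | ε ∈ Icc (0 : ℝ) 1 ∧ ∀ p ∈ Icc (0 : ℝ) 1, 0 ≤ singlePotential l r ε p} := by
  refine isCompact_Icc.of_isClosed_subset ?_ fun x hx => hx.1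
  have : {ε : ℝ | ε ∈ Icc (0 : ℝ) 1 ∧ ∀ p ∈ Icc (0 : ℝ) 1, 0 ≤ singlePotential l r ε p}
      = Icc 0 1 ∩ ⋂ p ∈ Icc (0 : ℝ) 1, {ε | 0 ≤ singlePotential l r ε p} := by
    ext; simp
  rw [this]
  refine isClosed_Icc.inter (isClosed_biInter fun p _ => ?_)
  refine isClosed_le continuous_const ?_
  unfold singlePotential
  fun_prop

theorem epsMAP_mem (hr : 3 ≤ r) : epsMAP l r ∈
    {ε : ℝ | ε ∈ Icc (0 : ℝ) 1 ∧ ∀ p ∈ Icc (0 : ℝ) 1, 0 ≤ singlePotential l r ε p} := by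
  refine (mapSet_isCompact l r).sSup_mem ⟨0, ⟨le_rfl, zero_le_one⟩, fun p hp => ?_⟩
  rw [singlePotential_zero_eps]
  rcases hp.1.eq_or_lt with h | h
  · rw [← h, checkPotential_zero]
  · exact (checkPotential_pos hr h hp.2).le

/-- Close to the origin the check part of the potential dominates, uniformly in the channel
parameter. -/
theorem exists_singlePotential_nonneg_near_zero (hl : 3 ≤ l) (hr : 3 ≤ r) :
    ∃ δ : ℝ, 0 < δ ∧ δ < 1 ∧ ∀ ε ≤ 1, ∀ p ∈ Icc (0 : ℝ) δ, 0 ≤ singlePotential l r ε p := by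
  have hr3 : (3 : ℝ) ≤ r := by exact_mod_cast hr
  have hr1 : (0 : ℝ) < (r : ℝ) - 1 := by linarith
  have hl0 : (0 : ℝ) < l := by positivity
  -- For $x\le1/r$ one has $x(r-1)\le1$, hence $x^2\le x/(r-1)$.
  refine ⟨1 / (r : ℝ), by positivity, by rw [div_lt_one (by linarith)]; linarith,
    fun ε hε p hp => ?_⟩
  have hp1 : p ≤ 1 := hp.2.trans (by rw [div_le_one (by linarith)]; linarith)
  -- the derivative is at least `p / (r - 1) - p ^ 2`
  have hbern : ∀ x ∈ Icc (0 : ℝ) 1, x / ((r : ℝ) - 1) ≤ checkInv r x := fun x hx => by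
    have := rpow_one_add_le_one_add_mul_self (by linarith [hx.2] : -1 ≤ -x)
      (checkInv_exponent_pos hr).le (checkInv_exponent_lt_one hr).le
    rw [← sub_eq_add_neg] at this
    have e : x / ((r : ℝ) - 1) = 1 / ((r : ℝ) - 1) * x := by ring
    unfold checkInv; linarith
  have hmono : MonotoneOn (singlePotential l r ε) (Icc 0 (1 / (r : ℝ))) := by
    refine monotoneOn_of_deriv_nonneg (convex_Icc _ _)
      (continuous_singlePotential hl hr ε).continuousOn
      (fun x _ => (hasDerivAt_singlePotential hl hr ε x).differentiableAt.differentiableWithinAt)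
      fun x hx => ?_
    rw [interior_Icc] at hx
    rw [(hasDerivAt_singlePotential hl hr ε x).deriv]
    have hx1 : x ≤ 1 := hx.2.le.trans (by rw [div_le_one (by linarith)]; linarith)
    have h1 := hbern x ⟨hx.1.le, hx1⟩
    have h2 : ε * x ^ (l - 1) ≤ x ^ 2 := by
      calc ε * x ^ (l - 1) ≤ 1 * x ^ (l - 1) :=
            mul_le_mul_of_nonneg_right hε (pow_nonneg hx.1.le _)
        _ = x ^ (l - 1) := one_mul _
        _ ≤ x ^ 2 := pow_le_pow_of_le_one hx.1.le hx1 (by omega)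
    have h3 : x ^ 2 ≤ x / ((r : ℝ) - 1) := by
      rw [le_div_iff₀ hr1]
      have h4 : x * ((r : ℝ) - 1) ≤ 1 := by
        have := hx.2.le
        rw [le_div_iff₀ (by linarith)] at this
        linarith [hx.1]
      nlinarith [hx.1]
    linarith
  have := hmono ⟨le_rfl, by positivity⟩ hp hp.1
  rwa [singlePotential_eq l r ε 0, checkPotential_zero, zero_pow (by omega), mul_zero,
    sub_zero] at this

/-- Without a nontrivial zero, $W_s$ has a positive minimum $\mu$ on $[\delta,1]$. Raising
$\varepsilon$ by at most $\mu$ then keeps $W_s\ge0$, as $p^l/l\le1$, and $[0,\delta]$ is safe for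
every $\varepsilon\le1$. This contradicts maximality. -/
theorem exists_zero_epsMAP (hl : 3 ≤ l) (hlr : l ≤ r) :
    ∃ p ∈ Ioc (0 : ℝ) 1, singlePotential l r (epsMAP l r) p = 0 := by
  have hr : 3 ≤ r := hl.trans hlr
  have hl0 : (0 : ℝ) < l := by positivity
  obtain ⟨hI, hA⟩ := epsMAP_mem (l := l) hr
  obtain ⟨δ, hδ, hδ1, hnear⟩ := exists_singlePotential_nonneg_near_zero hl hr
  by_contra! hne
  have hposn : ∀ p ∈ Icc δ 1, 0 < singlePotential l r (epsMAP l r) p := fun p hp =>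
    lt_of_le_of_ne (hA p ⟨hδ.le.trans hp.1, hp.2⟩) (hne p ⟨hδ.trans_le hp.1, hp.2⟩).symm
  obtain ⟨q, hq, hmin⟩ := isCompact_Icc.exists_isMinOn ⟨1, hδ1.le, le_rfl⟩
    (continuous_singlePotential hl hr (epsMAP l r)).continuousOn (s := Icc δ 1)
  have hμ := hposn q hq
  set μ := singlePotential l r (epsMAP l r) q
  -- If the threshold is already $1$ it cannot be raised, but then $W_s(1,1)=1/r-1/l\le0$ because
  -- $l\le r$.
  rcases hI.2.eq_or_lt with h1 | h1
  · have h := hposn 1 ⟨hδ1.le, le_rfl⟩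
    have hr3 : (3 : ℝ) ≤ r := by exact_mod_cast hr
    have he : (r : ℝ) / ((r : ℝ) - 1) ≠ 0 := by
      apply div_ne_zero <;> linarith
    have hle : (l : ℝ) ≤ r := by exact_mod_cast hlr
    rw [h1, singlePotential, sub_self, Real.zero_rpow he] at h
    have : 1 / (r : ℝ) ≤ 1 / l := one_div_le_one_div_of_le hl0 hle
    simp at h this
    linarith
  · set ε' := min 1 (epsMAP l r + μ)
    have hlt : epsMAP l r < ε' := lt_min h1 (by linarith)
    have hmem : ε' ∈ {ε : ℝ | ε ∈ Icc (0 : ℝ) 1 ∧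
        ∀ p ∈ Icc (0 : ℝ) 1, 0 ≤ singlePotential l r ε p} := by
      refine ⟨⟨hI.1.trans hlt.le, min_le_left _ _⟩, fun p hp => ?_⟩
      rcases le_or_gt p δ with hpδ | hpδ
      · exact hnear ε' (min_le_left _ _) p ⟨hp.1, hpδ⟩
      · have hm : μ ≤ singlePotential l r (epsMAP l r) p := hmin ⟨hpδ.le, hp.2⟩
        have hd : singlePotential l r ε' p
            = singlePotential l r (epsMAP l r) p - (ε' - epsMAP l r) * (p ^ l / l) := by
          simp only [singlePotential_eq]; ring
        have hpl : p ^ l / l ≤ 1 := by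
          rw [div_le_one hl0]
          have h1l : (1 : ℝ) ≤ l := by exact_mod_cast (by omega : 1 ≤ l)
          exact (pow_le_one₀ hp.1 hp.2).trans h1l
        have h3 : ε' - epsMAP l r ≤ μ := by
          have := min_le_right 1 (epsMAP l r + μ); linarith
        have h4 : (ε' - epsMAP l r) * (p ^ l / l) ≤ μ * 1 :=
          mul_le_mul h3 hpl (div_nonneg (pow_nonneg hp.1 _) hl0.le) hμ.le
        rw [hd]; linarith
    have : ε' ≤ epsMAP l r := le_csSup (mapSet_isCompact l r).bddAbove hmem
    linarith

theorem isCritical_MAP (hl : 3 ≤ l) (hlr : l ≤ r) : IsCritical l r (epsMAP l r) (pMAP l r) := by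
  have hr : 3 ≤ r := hl.trans hlr
  obtain ⟨hI, hA⟩ := epsMAP_mem (l := l) hr
  obtain ⟨q, hq, hq0⟩ := exists_zero_epsMAP hl hlr
  have hc : IsCompact {p : ℝ | p ∈ Icc (0 : ℝ) 1 ∧ singlePotential l r (epsMAP l r) p = 0} :=
    isCompact_Icc.inter_right
      (isClosed_singleton.preimage (continuous_singlePotential hl hr (epsMAP l r)))
  have hqm : q ∈ {p : ℝ | p ∈ Icc (0 : ℝ) 1 ∧ singlePotential l r (epsMAP l r) p = 0} :=
    ⟨⟨hq.1.le, hq.2⟩, hq0⟩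
  have hmem : pMAP l r ∈ _ := hc.sSup_mem ⟨q, hqm⟩
  exact isCritical_of_zero hl hlr hI.2 (hq.1.trans_le (le_csSup hc.bddAbove hqm)) hmem.1.2 hA hmem.2

end MAP

/-! ### The density-evolution operator and its comparison principle -/

noncomputable section

/-- The average of `p` over the unit window to the right of `z`. -/
def windowAvg (p : ℝ → ℝ) (z : ℝ) : ℝ := ∫ u in (0 : ℝ)..1, p (z + u)

/-- The edge average that drives the density evolution. -/
def edgeAvg (l : ℕ) (p : ℝ → ℝ) (z : ℝ) : ℝ := ∫ v in (0 : ℝ)..1, windowAvg p (z - v) ^ (l - 1)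

/-- The density-evolution operator. -/
def deOp (l r : ℕ) (ε : ℝ) (p : ℝ → ℝ) (z : ℝ) : ℝ :=
  1 - (1 - ε * edgeAvg l p z) ^ (r - 1)

end

/-- A continuous increasing profile that connects `0` to `P`. -/
structure IsFront (P : ℝ) (p : ℝ → ℝ) : Prop where
  continuous : Continuous p
  monotone : Monotone p
  tendsto_atBot : Tendsto p atBot (𝓝 0)
  tendsto_atTop : Tendsto p atTop (𝓝 P)

namespace IsFront

variable {P : ℝ} {p : ℝ → ℝ}

theorem mem_Icc (h : IsFront P p) (z : ℝ) : p z ∈ Icc 0 P :=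
  ⟨h.monotone.le_of_tendsto h.tendsto_atBot z, h.monotone.ge_of_tendsto h.tendsto_atTop z⟩

theorem comp_add (h : IsFront P p) (c : ℝ) : IsFront P fun z => p (z + c) :=
  ⟨h.continuous.comp (continuous_id.add continuous_const),
    fun _ _ hab => h.monotone (by linarith),
    h.tendsto_atBot.comp (tendsto_atBot_add_const_right _ c tendsto_id),
    h.tendsto_atTop.comp (tendsto_atTop_add_const_right _ c tendsto_id)⟩

end IsFront

theorem isFront_of_mem_increasingProfiles {P : ℝ} {p : ℝ → ℝ} (h : p ∈ increasingProfiles P) :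
    IsFront P p := by
  obtain ⟨⟨hc, -, hb, ht⟩, hm⟩ := h
  refine ⟨hc, hm, ?_, ?_⟩
  · have := hb.mul tendsto_inv_atBot_zero
    rw [zero_mul] at this
    refine this.congr' ?_
    filter_upwards [eventually_lt_atBot 0] with z hz
    rw [mul_comm z, mul_assoc, mul_inv_cancel₀ hz.ne, mul_one]
  · have := (ht.mul tendsto_inv_atTop_zero).add_const P
    rw [zero_mul, zero_add] at this
    refine this.congr' ?_
    filter_upwards [eventually_gt_atTop 0] with z hz
    rw [mul_comm z, mul_assoc, mul_inv_cancel₀ hz.ne']; ring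

theorem continuous_windowAvg {p : ℝ → ℝ} (hp : Continuous p) : Continuous (windowAvg p) := by
  unfold windowAvg
  apply intervalIntegral.continuous_parametric_intervalIntegral_of_continuous'
  fun_prop

theorem continuous_edgeAvg (l : ℕ) {p : ℝ → ℝ} (hp : Continuous p) : Continuous (edgeAvg l p) := by
  have := continuous_windowAvg hp
  unfold edgeAvg
  apply intervalIntegral.continuous_parametric_intervalIntegral_of_continuous'
  fun_prop

theorem continuous_deOp (l r : ℕ) (ε : ℝ) {p : ℝ → ℝ} (hp : Continuous p) :
    Continuous (deOp l r ε p) := by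
  have := continuous_edgeAvg l hp
  unfold deOp
  fun_prop

theorem integral_unit_mem_Icc {f : ℝ → ℝ} {a b : ℝ} (hf : Continuous f)
    (h : ∀ u ∈ Icc (0 : ℝ) 1, f u ∈ Icc a b) : ∫ u in (0 : ℝ)..1, f u ∈ Icc a b := by
  constructor
  · have := intervalIntegral.integral_mono_on (μ := volume) (zero_le_one' ℝ)
      (intervalIntegrable_const (c := a)) (hf.intervalIntegrable 0 1)
      fun u hu => (h u hu).1
    simpa using this
  · have := intervalIntegral.integral_mono_on (μ := volume) (zero_le_one' ℝ) (hf.intervalIntegrable 0 1)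
      (intervalIntegrable_const (c := b)) fun u hu => (h u hu).2
    simpa using this

theorem integral_unit_le_add {f g : ℝ → ℝ} {m : ℝ} (hf : Continuous f) (hg : Continuous g)
    (h : ∀ u ∈ Icc (0 : ℝ) 1, f u ≤ g u + m) :
    ∫ u in (0 : ℝ)..1, f u ≤ (∫ u in (0 : ℝ)..1, g u) + m := by
  have := intervalIntegral.integral_mono_on (μ := volume) (zero_le_one' ℝ) (hf.intervalIntegrable 0 1)
    ((by fun_prop : Continuous fun u => g u + m).intervalIntegrable 0 1) h
  rw [intervalIntegral.integral_add (hg.intervalIntegrable 0 1)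
    intervalIntegrable_const] at this
  simpa using this

theorem pow_succ_le_add {x y b d : ℝ} (hx : 0 ≤ x) (hy : 0 ≤ y) (hxb : x ≤ b) (hyb : y ≤ b)
    (hd : 0 ≤ d) (h : x ≤ y + d) (n : ℕ) : x ^ (n + 1) ≤ y ^ (n + 1) + (n + 1) * b ^ n * d := by
  have hb : 0 ≤ b := hx.trans hxb
  rcases le_total x y with hxy | hxy
  · have := pow_le_pow_left₀ hx hxy (n + 1)
    have : 0 ≤ (n + 1) * b ^ n * d := by positivity
    linarith
  · have h1 := (le_abs_self _).trans (abs_pow_succ_sub_pow_succ_le hx hy hxb hyb n)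
    rw [abs_of_nonneg (by linarith)] at h1
    have h2 : (n + 1) * b ^ n * (x - y) ≤ (n + 1) * b ^ n * d := by
      apply mul_le_mul_of_nonneg_left _ (by positivity); linarith
    linarith

theorem deOp_translate (l r : ℕ) (ε : ℝ) (p : ℝ → ℝ) (c z : ℝ) :
    deOp l r ε (fun y => p (y + c)) z = deOp l r ε p (z + c) := by
  simp only [deOp, edgeAvg, windowAvg]
  simp only [show ∀ v u, z - v + u + c = z + c - v + u from fun v u => by ring]

theorem deOp_zero {l : ℕ} (hl : 3 ≤ l) (r : ℕ) (ε z : ℝ) : deOp l r ε (fun _ => 0) z = 0 := by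
  simp [deOp, edgeAvg, windowAvg, zero_pow (by omega : l - 1 ≠ 0)]

namespace IsCritical

variable {l r : ℕ} {ε P : ℝ}

theorem deOp_const (h : IsCritical l r ε P) (z : ℝ) : deOp l r ε (fun _ => P) z = P := by
  simpa [deOp, edgeAvg, windowAvg] using h.fixed

theorem edgeAvg_mem {a b : ℝ} {q : ℝ → ℝ} (hq : Continuous q) {z : ℝ} (ha : 0 ≤ a)
    (hqm : ∀ y ∈ Icc (z - 1) (z + 1), q y ∈ Icc a b) :
    edgeAvg l q z ∈ Icc (a ^ (l - 1)) (b ^ (l - 1)) := by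
  have hw := continuous_windowAvg hq
  refine integral_unit_mem_Icc (by fun_prop) fun v hv => ?_
  have : windowAvg q (z - v) ∈ Icc a b :=
    integral_unit_mem_Icc (by fun_prop) fun u hu =>
      hqm _ ⟨by linarith [hu.1, hv.2], by linarith [hu.2, hv.1]⟩
  exact ⟨pow_le_pow_left₀ ha this.1 _, pow_le_pow_left₀ (ha.trans this.1) this.2 _⟩

/-- The comparison principle for the density-evolution operator. -/
theorem deOp_le_add (h : IsCritical l r ε P) {a b m z : ℝ} {q s : ℝ → ℝ} (hq : Continuous q)
    (hs : Continuous s) (ha : 0 ≤ a) (hb : b ≤ P) (hm : 0 ≤ m)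
    (hqm : ∀ y ∈ Icc (z - 1) (z + 1), q y ∈ Icc a b)
    (hsm : ∀ y ∈ Icc (z - 1) (z + 1), s y ∈ Icc a b)
    (hle : ∀ y ∈ Icc (z - 1) (z + 1), s y ≤ q y + m) :
    deOp l r ε s z ≤ deOp l r ε q z + contractionRate l r ε a b * m := by
  have hl := h.three_le
  have hr := h.three_le_right
  have hwq := continuous_windowAvg hq
  have hws := continuous_windowAvg hs
  have hz : z ∈ Icc (z - 1) (z + 1) := ⟨by linarith, by linarith⟩
  have hb0 : 0 ≤ b := ha.trans ((hqm z hz).1.trans (hqm z hz).2)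
  have heq := edgeAvg_mem (l := l) hq ha hqm
  have hes := edgeAvg_mem (l := l) hs ha hsm
  have hedge : edgeAvg l s z ≤ edgeAvg l q z + ((l - 1 : ℕ) : ℝ) * b ^ (l - 2) * m := by
    refine integral_unit_le_add (by fun_prop) (by fun_prop) fun v hv => ?_
    have hin : ∀ u ∈ Icc (0 : ℝ) 1, z - v + u ∈ Icc (z - 1) (z + 1) := fun u hu =>
      ⟨by linarith [hu.1, hv.2], by linarith [hu.2, hv.1]⟩
    have h1 : windowAvg q (z - v) ∈ Icc a b :=
      integral_unit_mem_Icc (by fun_prop) fun u hu => hqm _ (hin u hu)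
    have h2 : windowAvg s (z - v) ∈ Icc a b :=
      integral_unit_mem_Icc (by fun_prop) fun u hu => hsm _ (hin u hu)
    have h3 : windowAvg s (z - v) ≤ windowAvg q (z - v) + m :=
      integral_unit_le_add (by fun_prop) (by fun_prop) fun u hu => hle _ (hin u hu)
    have := pow_succ_le_add (ha.trans h2.1) (ha.trans h1.1) h2.2 h1.2 hm h3 (l - 2)
    rw [show l - 2 + 1 = l - 1 by omega] at this
    convert this using 3
    rw [show l - 1 = l - 2 + 1 by omega]; push_cast; ring
  have hε := h.eps_pos
  have hB : ∀ x ∈ Icc (a ^ (l - 1)) (b ^ (l - 1)), 0 ≤ 1 - ε * x ∧ 1 - ε * x ≤ 1 - ε * a ^ (l - 1) :=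
    fun x hx => by
      have h1 : ε * x ≤ ε * b ^ (l - 1) := mul_le_mul_of_nonneg_left hx.2 hε.le
      have h2 : ε * a ^ (l - 1) ≤ ε * x := mul_le_mul_of_nonneg_left hx.1 hε.le
      have h3 := h.eps_mul_pow_le hb0 hb (l - 1)
      constructor <;> linarith
  -- The profiles exchange roles because $t\mapsto1-\varepsilon t$ reverses the order.
  have := pow_succ_le_add (hB _ heq).1 (hB _ hes).1 (hB _ heq).2 (hB _ hes).2
    (d := ε * (((l - 1 : ℕ) : ℝ) * b ^ (l - 2) * m)) (by positivity)
    (by have := mul_le_mul_of_nonneg_left hedge hε.le; linarith) (r - 2)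
  rw [show r - 2 + 1 = r - 1 by omega] at this
  have e : ((r - 2 : ℕ) : ℝ) + 1 = ((r - 1 : ℕ) : ℝ) := by
    rw [show r - 1 = r - 2 + 1 by omega]; push_cast; ring
  rw [e] at this
  unfold deOp contractionRate
  linarith

theorem deOp_mono (h : IsCritical l r ε P) {z : ℝ} {q s : ℝ → ℝ} (hq : Continuous q)
    (hs : Continuous s) (hqm : ∀ y, q y ∈ Icc 0 P) (hsm : ∀ y, s y ∈ Icc 0 P)
    (hle : ∀ y ∈ Icc (z - 1) (z + 1), s y ≤ q y) : deOp l r ε s z ≤ deOp l r ε q z := by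
  have := h.deOp_le_add hq hs le_rfl le_rfl le_rfl (fun y _ => hqm y) (fun y _ => hsm y)
    (fun y hy => by simpa using hle y hy)
  simpa using this

theorem deOp_mem (h : IsCritical l r ε P) {q : ℝ → ℝ} (hq : Continuous q)
    (hqm : ∀ y, q y ∈ Icc 0 P) (z : ℝ) : deOp l r ε q z ∈ Icc 0 P := by
  have hP := h.pos.le
  constructor
  · rw [← deOp_zero h.three_le r ε z]
    exact h.deOp_mono hq continuous_const hqm (fun _ => ⟨le_rfl, hP⟩) fun y _ => (hqm y).1
  · conv_rhs => rw [← h.deOp_const z]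
    exact h.deOp_mono continuous_const hq (fun _ => ⟨hP, le_rfl⟩) hqm fun y _ => (hqm y).2

/-- Comparison with the constant solution $0$: the largest value of `q` on the window is `q (z +
1)`, which serves as the excess. -/
theorem deOp_le_mul (h : IsCritical l r ε P) {b z : ℝ} {q : ℝ → ℝ} (hq : Continuous q)
    (hqm : Monotone q) (hq0 : ∀ y, 0 ≤ q y) (hb : b ≤ P) (hqb : q (z + 1) ≤ b) :
    deOp l r ε q z ≤ contractionRate l r ε 0 b * q (z + 1) := by
  have := h.deOp_le_add (z := z) (a := 0) (b := b) (m := q (z + 1)) continuous_const hq le_rfl hb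
    (hq0 _) (fun y _ => ⟨le_rfl, (hq0 (z + 1)).trans hqb⟩)
    (fun y hy => ⟨hq0 y, (hqm hy.2).trans hqb⟩)
    (fun y hy => by rw [zero_add]; exact hqm hy.2)
  rwa [deOp_zero h.three_le, zero_add] at this

theorem sub_deOp_le_mul (h : IsCritical l r ε P) {a z : ℝ} {q : ℝ → ℝ} (hq : Continuous q)
    (hqm : Monotone q) (hqP : ∀ y, q y ≤ P) (ha : 0 ≤ a) (hqa : a ≤ q (z - 1)) :
    P - deOp l r ε q z ≤ contractionRate l r ε a P * (P - q (z - 1)) := by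
  have := h.deOp_le_add (z := z) (a := a) (b := P) (m := P - q (z - 1)) hq continuous_const ha
    le_rfl (sub_nonneg.2 (hqP _)) (fun y hy => ⟨hqa.trans (hqm hy.1), hqP y⟩)
    (fun y _ => ⟨hqa.trans (hqP _), le_rfl⟩) (fun y hy => by linarith [hqm hy.1])
  rw [h.deOp_const] at this
  linarith

theorem deOp_monotone (h : IsCritical l r ε P) {q : ℝ → ℝ} (hq : Continuous q)
    (hqm : ∀ y, q y ∈ Icc 0 P) (hmono : Monotone q) : Monotone (deOp l r ε q) := by
  intro x y hxy
  have h1 := deOp_translate l r ε q (y - x) x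
  rw [add_sub_cancel] at h1
  rw [← h1]
  exact h.deOp_mono (by fun_prop) hq (fun _ => hqm _) hqm fun w _ => hmono (by linarith)

/-- The edge average integrates a function with values in $[0,1]$ over $[z-1,z]$; moving this
interval gains at most the length of the move. -/
theorem edgeAvg_le_add {q : ℝ → ℝ} (hq : Continuous q) (hqm : ∀ y, q y ∈ Icc (0 : ℝ) 1)
    {x y : ℝ} (hxy : x ≤ y) : edgeAvg l q y ≤ edgeAvg l q x + (y - x) := by
  have hw := continuous_windowAvg hq
  set f : ℝ → ℝ := fun w => windowAvg q w ^ (l - 1)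
  have hf : Continuous f := by fun_prop
  have hfm : ∀ w, f w ∈ Icc (0 : ℝ) 1 := fun w => by
    have : windowAvg q w ∈ Icc (0 : ℝ) 1 :=
      integral_unit_mem_Icc (by fun_prop) fun u _ => hqm _
    exact ⟨pow_nonneg this.1 _, pow_le_one₀ this.1 this.2⟩
  have he : ∀ w, edgeAvg l q w = ∫ t in (w - 1)..w, f t := fun w => by
    have := intervalIntegral.integral_comp_sub_left (a := 0) (b := 1) f w
    rwa [sub_zero] at this
  have hi : ∀ a b, IntervalIntegrable f volume a b := fun a b => hf.intervalIntegrable a b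
  have hsub := intervalIntegral.integral_interval_sub_interval_comm' (hi (y - 1) y)
    (hi (x - 1) x) (hi (y - 1) (x - 1))
  rw [he, he]
  have h1 : ∫ t in x..y, f t ≤ ∫ _ in x..y, (1 : ℝ) :=
    intervalIntegral.integral_mono_on hxy (hi _ _) intervalIntegrable_const fun t _ => (hfm t).2
  have h2 : 0 ≤ ∫ t in (x - 1)..(y - 1), f t :=
    intervalIntegral.integral_nonneg (by linarith) fun t _ => (hfm t).1
  simp only [intervalIntegral.integral_const, smul_eq_mul, mul_one] at h1
  linarith

/-- The smoothing effect of $T$: the slope bound does not depend on the profile. It supplies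
compactness for minimizing sequences and a Lipschitz bound for fixed points. -/
theorem deOp_le_add_mul (h : IsCritical l r ε P) {q : ℝ → ℝ} (hq : Continuous q)
    (hqm : ∀ y, q y ∈ Icc 0 P) {x y : ℝ} (hxy : x ≤ y) :
    deOp l r ε q y ≤ deOp l r ε q x + r * (y - x) := by
  have hr := h.three_le_right
  have hε := h.eps_pos
  have hd : 0 ≤ y - x := sub_nonneg.2 hxy
  have hedge := edgeAvg_le_add (l := l) hq
    (fun w => ⟨(hqm w).1, (hqm w).2.trans h.le_one⟩) hxy
  have hB : ∀ w, 0 ≤ 1 - ε * edgeAvg l q w ∧ 1 - ε * edgeAvg l q w ≤ 1 := fun w => by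
    have := edgeAvg_mem (l := l) hq le_rfl (z := w) fun y _ => hqm y
    rw [zero_pow (by have := h.three_le; omega)] at this
    have h1 : ε * edgeAvg l q w ≤ ε * P ^ (l - 1) := mul_le_mul_of_nonneg_left this.2 hε.le
    have h2 : 0 ≤ ε * edgeAvg l q w := mul_nonneg hε.le this.1
    have h3 := h.eps_mul_pow_le h.pos.le le_rfl (l - 1)
    constructor <;> linarith
  have hstep : ε * edgeAvg l q y ≤ ε * edgeAvg l q x + (y - x) := by
    have h1 := mul_le_mul_of_nonneg_left hedge hε.le
    have h2 := mul_le_mul_of_nonneg_right h.eps_le hd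
    linarith
  have := pow_succ_le_add (hB x).1 (hB y).1 (hB x).2 (hB y).2 hd (by linarith) (r - 2)
  rw [show r - 2 + 1 = r - 1 by omega, one_pow, mul_one] at this
  have e : ((r - 2 : ℕ) : ℝ) + 1 ≤ r := by
    have : ((r - 2 : ℕ) : ℝ) = r - 2 := by rw [Nat.cast_sub (by omega)]; simp
    linarith
  have := mul_le_mul_of_nonneg_right e hd
  unfold deOp
  linarith

theorem isDESolution_iff (h : IsCritical l r ε P) {p : ℝ → ℝ} (hp : Continuous p)
    (hpm : ∀ y, p y ∈ Icc 0 P) : IsDESolution l r ε p ↔ deOp l r ε p = p := by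
  have hr := h.three_le_right
  rw [funext_iff]
  refine forall_congr' fun z => ?_
  have hedge := edgeAvg_mem (l := l) hp le_rfl (z := z) fun y _ => hpm y
  have hle : ε * edgeAvg l p z ≤ 1 :=
    (mul_le_mul_of_nonneg_left hedge.2 h.eps_pos.le).trans (h.eps_mul_pow_le h.pos.le le_rfl _)
  have e : (∫ v in (0 : ℝ)..1, (∫ u in (0 : ℝ)..1, p (z + u - v)) ^ (l - 1)) = edgeAvg l p z := by
    simp only [edgeAvg, windowAvg]
    simp only [show ∀ v u, z - v + u = z + u - v from fun v u => by ring]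
  rw [e]
  exact (checkInv_eq_iff hr ((hpm z).2.trans h.le_one) hle).trans eq_comm

end IsCritical

/-! ### Tails of fronts -/

/-- Iterating about $x-N$ times gives $g(x)\le\kappa^{\lfloor x-N\rfloor}B$, and geometric decay
beats the factor $x$. -/
theorem tendsto_mul_of_le_mul_pred {g : ℝ → ℝ} {B N κ : ℝ} (hg0 : ∀ x, 0 ≤ g x)
    (hgB : ∀ x, g x ≤ B) (hκ : 0 ≤ κ) (hκ1 : κ < 1) (hg : ∀ x, N ≤ x → g x ≤ κ * g (x - 1)) :
    Tendsto (fun x => x * g x) atTop (𝓝 0) := by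
  have hB : 0 ≤ B := (hg0 0).trans (hgB 0)
  have hind : ∀ n : ℕ, ∀ x, N + n ≤ x → g x ≤ κ ^ n * B := by
    intro n
    induction n with
    | zero => intro x _; simpa using hgB x
    | succ n ih =>
      intro x hx
      push_cast at hx
      have hn : (0 : ℝ) ≤ n := n.cast_nonneg
      calc g x ≤ κ * g (x - 1) := hg x (by linarith)
        _ ≤ κ * (κ ^ n * B) := mul_le_mul_of_nonneg_left (ih _ (by linarith)) hκ
        _ = _ := by ring
  have hlim : Tendsto (fun n : ℕ => ((n : ℝ) * κ ^ n + (1 + |N|) * κ ^ n) * B) atTop (𝓝 0) := by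
    have h1 := tendsto_self_mul_const_pow_of_lt_one hκ hκ1
    have h2 := (tendsto_pow_atTop_nhds_zero_of_lt_one hκ hκ1).const_mul (1 + |N|)
    simpa using (h1.add h2).mul_const B
  have hfl : Tendsto (fun x : ℝ => ⌊x - N⌋₊) atTop atTop :=
    tendsto_nat_floor_atTop.comp (tendsto_atTop_add_const_right _ (-N) tendsto_id)
  refine squeeze_zero' ?_ ?_ (hlim.comp hfl)
  · filter_upwards [eventually_ge_atTop 0] with x hx using mul_nonneg hx (hg0 x)
  · filter_upwards [eventually_ge_atTop 0, eventually_ge_atTop N] with x hx hxN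
    have h1 : (⌊x - N⌋₊ : ℝ) ≤ x - N := Nat.floor_le (by linarith)
    have h2 : x - N < ⌊x - N⌋₊ + 1 := Nat.lt_floor_add_one _
    have h3 := hind ⌊x - N⌋₊ x (by linarith)
    have h4 : x ≤ ⌊x - N⌋₊ + (1 + |N|) := by linarith [le_abs_self N]
    calc x * g x ≤ (⌊x - N⌋₊ + (1 + |N|)) * (κ ^ ⌊x - N⌋₊ * B) :=
          mul_le_mul h4 h3 (hg0 x) (hx.trans h4)
      _ = _ := by simp only [Function.comp]; ring

namespace IsCritical

variable {l r : ℕ} {ε P : ℝ}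

theorem deOp_isFront (h : IsCritical l r ε P) {p : ℝ → ℝ} (hp : IsFront P p) :
    IsFront P (deOp l r ε p) := by
  have hmem := h.deOp_mem hp.continuous hp.mem_Icc
  refine ⟨continuous_deOp l r ε hp.continuous,
    h.deOp_monotone hp.continuous hp.mem_Icc hp.monotone, ?_, ?_⟩
  · have h1 := ((hp.comp_add 1).tendsto_atBot).const_mul (contractionRate l r ε 0 P)
    rw [mul_zero] at h1
    exact squeeze_zero (fun z => (hmem z).1) (fun z => h.deOp_le_mul hp.continuous hp.monotone
      (fun y => (hp.mem_Icc y).1) le_rfl (hp.mem_Icc _).2) h1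
  · have h1 := (((hp.comp_add (-1)).tendsto_atTop).const_sub P).const_mul
      (contractionRate l r ε 0 P)
    rw [sub_self, mul_zero] at h1
    have h2 := squeeze_zero (fun z => sub_nonneg.2 (hmem z).2) (fun z =>
      h.sub_deOp_le_mul hp.continuous hp.monotone
      (fun y => (hp.mem_Icc y).2) le_rfl (hp.mem_Icc _).1) h1
    simpa using h2.const_sub P

/-- The tails of $Tp$ are at most a constant times those of $p$ shifted by one. The constant need
not be below $1$, and the shift only adds a term that vanishes at infinity. -/
theorem deOp_mem_increasingProfiles (h : IsCritical l r ε P) {p : ℝ → ℝ}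
    (hp : p ∈ increasingProfiles P) : deOp l r ε p ∈ increasingProfiles P := by
  have hf := isFront_of_mem_increasingProfiles hp
  have hT := h.deOp_isFront hf
  refine ⟨⟨hT.continuous, fun z => (hT.mem_Icc z).1, ?_, ?_⟩, hT.monotone⟩
  · have h1 := (hp.1.2.2.1.comp (tendsto_atBot_add_const_right _ 1 tendsto_id)).sub
      (hf.comp_add 1).tendsto_atBot
    have h2 := (h1.const_mul (contractionRate l r ε 0 P))
    rw [sub_zero, mul_zero] at h2
    refine squeeze_zero_norm' ?_ (neg_zero (G := ℝ) ▸ h2.neg)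
    filter_upwards [eventually_le_atBot 0] with z hz
    have h3 := h.deOp_le_mul (z := z) hf.continuous hf.monotone (fun y => (hf.mem_Icc y).1) le_rfl
      (hf.mem_Icc _).2
    rw [norm_mul, Real.norm_of_nonpos hz, Real.norm_of_nonneg (hT.mem_Icc z).1]
    have := mul_le_mul_of_nonneg_left h3 (neg_nonneg.2 hz)
    simp only [Function.comp, id]
    linarith
  · have h1 := (hp.1.2.2.2.comp (tendsto_atTop_add_const_right _ (-1) tendsto_id)).add
      ((hf.comp_add (-1)).tendsto_atTop.sub_const P)
    have h2 := (h1.const_mul (contractionRate l r ε 0 P))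
    rw [sub_self, add_zero, mul_zero] at h2
    refine squeeze_zero_norm' ?_ (neg_zero (G := ℝ) ▸ h2.neg)
    filter_upwards [eventually_ge_atTop 0] with z hz
    have h3 := h.sub_deOp_le_mul (z := z) hf.continuous hf.monotone (fun y => (hf.mem_Icc y).2)
      le_rfl (hf.mem_Icc _).1
    rw [norm_mul, Real.norm_of_nonneg hz, Real.norm_of_nonpos (sub_nonpos.2 (hT.mem_Icc z).2)]
    have := mul_le_mul_of_nonneg_left h3 hz
    simp only [Function.comp, id, ← sub_eq_add_neg]
    linarith

/-- Within $\eta$ of a limit, stationarity bounds the distance to that limit by $\kappa$ times the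
distance one unit closer to the centre. Decay is thus automatic for stationary fronts. -/
theorem mem_increasingProfiles_of_fixed (h : IsCritical l r ε P) {p : ℝ → ℝ} (hp : IsFront P p)
    (hfix : deOp l r ε p = p) : p ∈ increasingProfiles P := by
  obtain ⟨η, κ, hη, hηP, hκ, hκ1, hk0, hkP⟩ := h.exists_contraction
  refine ⟨⟨hp.continuous, fun z => (hp.mem_Icc z).1, ?_, ?_⟩, hp.monotone⟩
  · obtain ⟨N, hN⟩ := eventually_atBot.1 (hp.tendsto_atBot.eventually (gt_mem_nhds hη))
    have key := tendsto_mul_of_le_mul_pred (g := fun x => p (-x)) (B := P) (N := 1 - N)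
      (fun x => (hp.mem_Icc _).1) (fun x => (hp.mem_Icc _).2) hκ hκ1 fun x hx => by
        have h1 := h.deOp_le_mul (z := -x) (b := η) hp.continuous hp.monotone
          (fun y => (hp.mem_Icc y).1) hηP.le (hN _ (by linarith)).le
        rw [hfix, show -x + 1 = -(x - 1) by ring] at h1
        exact h1.trans (mul_le_mul_of_nonneg_right hk0 (hp.mem_Icc _).1)
    have := (key.comp tendsto_neg_atBot_atTop).neg
    simpa [Function.comp_def] using this
  · obtain ⟨N, hN⟩ := eventually_atTop.1 (hp.tendsto_atTop.eventually
      (lt_mem_nhds (by linarith : P - η < P)))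
    have key := tendsto_mul_of_le_mul_pred (g := fun x => P - p x) (B := P) (N := N + 1)
      (fun x => sub_nonneg.2 (hp.mem_Icc _).2) (fun x => by linarith [(hp.mem_Icc x).1]) hκ hκ1
      fun x hx => by
        have h1 := h.sub_deOp_le_mul (z := x) (a := P - η) hp.continuous hp.monotone
          (fun y => (hp.mem_Icc y).2) (by linarith) (hN _ (by linarith)).le
        rw [hfix] at h1
        exact h1.trans (mul_le_mul_of_nonneg_right hkP (sub_nonneg.2 (hp.mem_Icc _).2))
    have := key.neg
    rw [neg_zero] at this
    refine this.congr fun z => ?_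
    ring

end IsCritical

/-! ### Strong comparison and uniqueness up to translation -/

theorem eqOn_of_integral_unit_eq {f g : ℝ → ℝ} (hf : Continuous f) (hg : Continuous g)
    (hle : ∀ u, f u ≤ g u) (h : ∫ u in (0 : ℝ)..1, f u = ∫ u in (0 : ℝ)..1, g u) :
    ∀ u ∈ Icc (0 : ℝ) 1, f u = g u := by
  intro u hu
  by_contra hne
  have hlt := lt_of_le_of_ne (hle u) hne
  have := intervalIntegral.integral_pos zero_lt_one (hg.sub hf).continuousOn
    (fun x _ => sub_nonneg.2 (hle x)) ⟨u, hu, sub_pos.2 hlt⟩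
  simp only [Pi.sub_apply] at this
  rw [intervalIntegral.integral_sub (hg.intervalIntegrable 0 1) (hf.intervalIntegrable 0 1)] at this
  linarith

namespace IsCritical

variable {l r : ℕ} {ε P : ℝ} {p q : ℝ → ℝ}

theorem windowAvg_mem (hp : Continuous p) (hpm : ∀ y, p y ∈ Icc 0 P) (z : ℝ) :
    windowAvg p z ∈ Icc 0 P :=
  integral_unit_mem_Icc (by fun_prop) fun _ _ => hpm _

/-- Strong comparison: two ordered profiles with equal images at a point agree on the window. -/
theorem eqOn_window_of_deOp_eq (h : IsCritical l r ε P) (hp : Continuous p) (hq : Continuous q)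
    (hpm : ∀ y, p y ∈ Icc 0 P) (hqm : ∀ y, q y ∈ Icc 0 P) (hle : ∀ y, p y ≤ q y) {z : ℝ}
    (hz : deOp l r ε p z = deOp l r ε q z) : ∀ y ∈ Icc (z - 1) (z + 1), p y = q y := by
  have hr := h.three_le_right
  have hl := h.three_le
  have hwp := continuous_windowAvg hp
  have hwq := continuous_windowAvg hq
  have hB : ∀ {s : ℝ → ℝ}, Continuous s → (∀ y, s y ∈ Icc 0 P) → 0 ≤ 1 - ε * edgeAvg l s z :=
    fun hs hsm => by
      have := edgeAvg_mem (l := l) hs le_rfl (z := z) fun y _ => hsm y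
      have h1 := mul_le_mul_of_nonneg_left this.2 h.eps_pos.le
      have h3 := h.eps_mul_pow_le h.pos.le le_rfl (l - 1)
      linarith
  have hedge : edgeAvg l p z = edgeAvg l q z := by
    unfold deOp at hz
    have h1 := (pow_left_inj₀ (hB hp hpm) (hB hq hqm) (by omega : r - 1 ≠ 0)).1 (by linarith)
    have h2 : ε * edgeAvg l p z = ε * edgeAvg l q z := by linarith
    exact mul_left_cancel₀ h.eps_pos.ne' h2
  have hwle : ∀ x, windowAvg p x ≤ windowAvg q x := fun x => by
    have := integral_unit_le_add (f := fun u => p (x + u)) (g := fun u => q (x + u)) (m := 0)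
      (by fun_prop) (by fun_prop) fun u _ => by simpa using hle (x + u)
    rwa [add_zero] at this
  have h1 := eqOn_of_integral_unit_eq (by fun_prop) (by fun_prop)
    (fun v => pow_le_pow_left₀ (windowAvg_mem hp hpm _).1 (hwle (z - v)) (l - 1)) hedge
  have h2 : ∀ v ∈ Icc (0 : ℝ) 1, ∀ u ∈ Icc (0 : ℝ) 1, p (z - v + u) = q (z - v + u) := by
    intro v hv
    have h3 := (pow_left_inj₀ (windowAvg_mem hp hpm _).1 (windowAvg_mem hq hqm _).1
      (by omega : l - 1 ≠ 0)).1 (h1 v hv)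
    exact eqOn_of_integral_unit_eq (by fun_prop) (by fun_prop) (fun u => hle _) h3
  intro y hy
  -- The extreme values $v=0$ and $v=1$ already cover the right and left halves of the window.
  rcases le_total z y with hzy | hzy
  · have := h2 0 ⟨le_rfl, zero_le_one⟩ (y - z) ⟨by linarith, by linarith [hy.2]⟩
    simpa using this
  · have := h2 1 ⟨zero_le_one, le_rfl⟩ (y - z + 1) ⟨by linarith [hy.1], by linarith⟩
    rwa [show z - 1 + (y - z + 1) = y by ring] at this

/-- Equality at one point spreads to the window of radius $1$ around it, and by induction to the
whole line. -/
theorem eq_of_touch (h : IsCritical l r ε P) (hp : IsFront P p) (hq : IsFront P q)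
    (hfp : deOp l r ε p = p) (hfq : deOp l r ε q = q) (hle : ∀ y, p y ≤ q y) {z : ℝ}
    (hz : p z = q z) : p = q := by
  have hstep : ∀ x, p x = q x → ∀ y ∈ Icc (x - 1) (x + 1), p y = q y := fun x hx =>
    h.eqOn_window_of_deOp_eq hp.continuous hq.continuous hp.mem_Icc hq.mem_Icc hle
      (by rw [hfp, hfq, hx])
  have hall : ∀ n : ℕ, ∀ y ∈ Icc (z - n) (z + n), p y = q y := by
    intro n
    induction n with
    | zero =>
      intro y hy
      have : y = z := by
        have h1 := hy.1; have h2 := hy.2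
        simp at h1 h2; linarith
      rw [this, hz]
    | succ n ih =>
      intro y hy
      have hn : (0 : ℝ) ≤ n := n.cast_nonneg
      obtain ⟨h1, h2⟩ := hy
      push_cast at h1 h2
      rcases le_total z y with hzy | hzy
      · exact hstep (max z (y - 1)) (ih _ ⟨by linarith [le_max_left z (y - 1)],
          max_le (by linarith) (by linarith)⟩) y
          ⟨by linarith [max_le hzy (by linarith : y - 1 ≤ y)],
            by linarith [le_max_right z (y - 1)]⟩
      · exact hstep (min z (y + 1)) (ih _ ⟨le_min (by linarith) (by linarith),
          by linarith [min_le_left z (y + 1)]⟩) y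
          ⟨by linarith [min_le_right z (y + 1)],
            by linarith [le_min hzy (by linarith : y ≤ y + 1)]⟩
  funext y
  obtain ⟨n, hn⟩ := exists_nat_ge |y - z|
  have := abs_le.1 hn
  exact hall n y ⟨by linarith, by linarith⟩

theorem deOp_comp_add_eq (hfp : deOp l r ε p = p) (c : ℝ) :
    deOp l r ε (fun y => p (y + c)) = fun y => p (y + c) := by
  funext z
  rw [deOp_translate, hfp]

/-- If $p(x)=p(y)$ with $x<y$, then $p$ touches its translate by $y-x$, which lies above it. The two
coincide, so $p$ is periodic, which is incompatible with distinct limits at $\pm\infty$. -/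
theorem strictMono_of_fixed (h : IsCritical l r ε P) (hp : IsFront P p)
    (hfp : deOp l r ε p = p) : StrictMono p := by
  intro x y hxy
  refine lt_of_le_of_ne (hp.monotone hxy.le) fun heq => ?_
  have hc : 0 < y - x := sub_pos.2 hxy
  have hper := h.eq_of_touch hp (hp.comp_add (y - x)) hfp (deOp_comp_add_eq hfp (y - x))
    (fun w => hp.monotone (by linarith)) (z := x) (by simpa using heq)
  have hper' : ∀ w, p w = p (w + (y - x)) := fun w => congrFun hper w
  have hn : ∀ (n : ℕ) w, p (w + n * (y - x)) = p w := by
    intro n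
    induction n with
    | zero => intro w; simp
    | succ n ih =>
      intro w
      rw [← ih w, hper' (w + n * (y - x))]
      congr 1; push_cast; ring
  have hlim : ∀ w, p w = P := fun w => by
    have h1 : Tendsto (fun n : ℕ => w + n * (y - x)) atTop atTop :=
      tendsto_atTop_add_const_left _ _ (tendsto_natCast_atTop_atTop.atTop_mul_const hc)
    have h2 := hp.tendsto_atTop.comp h1
    have h3 : (p ∘ fun n : ℕ => w + n * (y - x)) = fun _ => p w := funext fun n => hn n w
    rw [h3] at h2
    exact tendsto_nhds_unique tendsto_const_nhds h2
  have h1 := hp.tendsto_atBot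
  rw [show p = fun _ => P from funext hlim] at h1
  exact h.pos.ne' (tendsto_nhds_unique tendsto_const_nhds h1)

/-- If two stationary fronts are ordered on a large window, then they are ordered everywhere. -/
theorem le_of_le_middle (h : IsCritical l r ε P) (hp : IsFront P p) (hq : IsFront P q)
    (hfp : deOp l r ε p = p) (hfq : deOp l r ε q = q) {η κ N : ℝ} (hηP : η < P)
    (hκ : 0 ≤ κ) (hκ1 : κ < 1) (hk0 : contractionRate l r ε 0 η ≤ κ)
    (hkP : contractionRate l r ε (P - η) P ≤ κ) (hpN : p (-N) ≤ η) (hqN : q (-N) ≤ η)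
    (hqN' : P - η ≤ q N) (hmid : ∀ z ∈ Icc (-N - 1) (N + 1), p z ≤ q z) : ∀ z, p z ≤ q z := by
  -- An excess $m$ of `p` over `q` shrinks to $\kappa m$: both tails lie where $T$ contracts, and in
  -- the middle there is no excess.
  have hstep : ∀ m, 0 ≤ m → (∀ z, p z ≤ q z + m) → ∀ z, p z ≤ q z + κ * m := by
    intro m hm hle z
    have hκm : 0 ≤ κ * m := mul_nonneg hκ hm
    rcases lt_or_ge z (-N - 1) with h1 | h1
    · have := h.deOp_le_add (z := z) hq.continuous hp.continuous le_rfl hηP.le hm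
        (fun y hy => ⟨(hq.mem_Icc y).1, (hq.monotone (by linarith [hy.2])).trans hqN⟩)
        (fun y hy => ⟨(hp.mem_Icc y).1, (hp.monotone (by linarith [hy.2])).trans hpN⟩)
        (fun y _ => hle y)
      rw [hfp, hfq] at this
      linarith [mul_le_mul_of_nonneg_right hk0 hm]
    rcases le_or_gt z (N + 1) with h2 | h2
    · linarith [hmid z ⟨h1, h2⟩]
    -- On the right only `q` is known to be near $P$. The maximum of both profiles is near $P$ too,
    -- exceeds `q` by at most `m`, and dominates `p`.
    · have hs : Continuous fun y => max (p y) (q y) := hp.continuous.max hq.continuous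
      have hq1 : ∀ y ∈ Icc (z - 1) (z + 1), P - η ≤ q y := fun y hy =>
        hqN'.trans (hq.monotone (by linarith [hy.1]))
      have h3 := h.deOp_le_add (z := z) hq.continuous hs (by linarith : 0 ≤ P - η) le_rfl hm
        (fun y hy => ⟨hq1 y hy, (hq.mem_Icc y).2⟩)
        (fun y hy => ⟨le_max_of_le_right (hq1 y hy), max_le (hp.mem_Icc y).2 (hq.mem_Icc y).2⟩)
        (fun y _ => max_le (hle y) (by linarith))
      have h4 := h.deOp_mono (z := z) hs hp.continuous
        (fun y => ⟨le_max_of_le_right (hq.mem_Icc y).1, max_le (hp.mem_Icc y).2 (hq.mem_Icc y).2⟩)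
        hp.mem_Icc (fun y _ => le_max_left _ _)
      rw [hfp] at h4
      rw [hfq] at h3
      linarith [mul_le_mul_of_nonneg_right hkP hm]
  have hind : ∀ n : ℕ, ∀ z, p z ≤ q z + κ ^ n * P := by
    intro n
    induction n with
    | zero => intro z; linarith [(hp.mem_Icc z).2, (hq.mem_Icc z).1]
    | succ n ih =>
      intro z
      have := hstep _ (mul_nonneg (pow_nonneg hκ n) h.pos.le) ih z
      rwa [pow_succ', mul_assoc]
  intro z
  have hlim := ((tendsto_pow_atTop_nhds_zero_of_lt_one hκ hκ1).mul_const P).const_add (q z)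
  rw [zero_mul, add_zero] at hlim
  exact ge_of_tendsto' hlim fun n => hind n z

/-- Stationary fronts are unique up to translation. -/
theorem exists_translate (h : IsCritical l r ε P) (hp : IsFront P p) (hq : IsFront P q)
    (hfp : deOp l r ε p = p) (hfq : deOp l r ε q = q) : ∃ τ : ℝ, ∀ z, q z = p (z - τ) := by
  obtain ⟨η, κ, hη, hηP, hκ, hκ1, hk0, hkP⟩ := h.exists_contraction
  have hpos : ∀ z, 0 < q z := fun z =>
    (hq.mem_Icc (z - 1)).1.trans_lt (h.strictMono_of_fixed hq hfq (by linarith))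
  have hltP : ∀ z, q z < P := fun z =>
    (h.strictMono_of_fixed hq hfq (by linarith : z < z + 1)).trans_le (hq.mem_Icc (z + 1)).2
  have hfront : ∀ τ, IsFront P fun z => p (z - τ) := fun τ => hp.comp_add (-τ)
  have hfix : ∀ τ, deOp l r ε (fun z => p (z - τ)) = fun z => p (z - τ) := fun τ =>
    deOp_comp_add_eq hfp (-τ)
  have hN : ∀ τ, ∃ N : ℝ, p (-N - τ) ≤ η ∧ q (-N) ≤ η ∧ P - η ≤ q N := fun τ => by
    have e1 := ((hfront τ).tendsto_atBot.comp tendsto_neg_atTop_atBot).eventually (gt_mem_nhds hη)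
    have e2 := (hq.tendsto_atBot.comp tendsto_neg_atTop_atBot).eventually (gt_mem_nhds hη)
    have e3 := hq.tendsto_atTop.eventually (lt_mem_nhds (by linarith : P - η < P))
    obtain ⟨N, ⟨h1, h2⟩, h3⟩ := ((e1.and e2).and e3).exists
    exact ⟨N, h1.le, h2.le, h3.le⟩
  -- the set of admissible shifts
  set A : Set ℝ := {τ | ∀ z, p (z - τ) ≤ q z} with hA
  have hne : A.Nonempty := by
    obtain ⟨N, h1, h2, h3⟩ := hN 0
    have e1 := hp.tendsto_atBot.comp (tendsto_atBot_add_const_left _ (N + 1)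
      tendsto_neg_atTop_atBot) |>.eventually (gt_mem_nhds (hpos (-N - 1)))
    obtain ⟨τ, hτ, hτ0⟩ := (e1.and (eventually_ge_atTop 0)).exists
    refine ⟨τ, h.le_of_le_middle (hfront τ) hq (hfix τ) hfq hηP hκ hκ1 hk0 hkP
      ((hp.monotone (by linarith)).trans h1) h2 h3 fun z hz => ?_⟩
    calc p (z - τ) ≤ p (N + 1 + -τ) := hp.monotone (by linarith [hz.2])
      _ ≤ q (-N - 1) := hτ.le
      _ ≤ q z := hq.monotone hz.1
  have hbdd : BddBelow A := by
    obtain ⟨B, hB⟩ := eventually_atTop.1 (hp.tendsto_atTop.eventually (lt_mem_nhds (hltP 0)))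
    refine ⟨-B, fun τ hτ => ?_⟩
    by_contra! hlt
    have h1 := hB (0 - τ) (by linarith)
    exact absurd (hτ 0) (not_le.2 h1)
  have hclosed : IsClosed A := by
    have : A = ⋂ z, {τ | p (z - τ) ≤ q z} := by ext; simp [hA]
    rw [this]
    have hc := hp.continuous
    exact isClosed_iInter fun z => isClosed_le (by fun_prop) continuous_const
  -- The extremal shift. If this translate touches `q`, they coincide; otherwise the gap on a
  -- compact window leaves room for a smaller shift, which is contradictory.
  set τ := sInf A
  have hτ : τ ∈ A := hclosed.csInf_mem hne hbdd
  refine ⟨τ, ?_⟩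
  by_contra! hcon
  have hlt : ∀ z, p (z - τ) < q z := fun z => by
    refine lt_of_le_of_ne (hτ z) fun heq => ?_
    obtain ⟨w, hw⟩ := hcon
    exact hw (congrFun (h.eq_of_touch (hfront τ) hq (hfix τ) hfq hτ heq) w).symm
  -- Choosing `N` for the shift `τ - 1` makes it valid for every `τ - δ` with `δ ≤ 1`.
  obtain ⟨N, h1, h2, h3⟩ := hN (τ - 1)
  obtain ⟨μ, hμ, hμle⟩ : ∃ μ > 0, ∀ z ∈ Icc (-N - 1) (N + 1), p (z - τ) + μ ≤ q z := by
    rcases (Icc (-N - 1) (N + 1)).eq_empty_or_nonempty with he | he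
    · exact ⟨1, one_pos, fun z hz => by simp [he] at hz⟩
    · obtain ⟨x, hx, hmin⟩ := isCompact_Icc.exists_isMinOn he
        (f := fun z => q z - p (z - τ)) (hq.continuous.sub (hfront τ).continuous).continuousOn
      refine ⟨q x - p (x - τ), sub_pos.2 (hlt x), fun z hz => ?_⟩
      have : q x - p (x - τ) ≤ q z - p (z - τ) := hmin hz
      linarith
  have hr0 : (0 : ℝ) < r := by have := h.three_le_right; positivity
  -- A fixed point has slope at most $r$, so this further slide raises `p` by at most the gap `μ`.
  set δ := min 1 (μ / r)
  have hδ : 0 < δ := lt_min one_pos (div_pos hμ hr0)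
  have hmem : τ - δ ∈ A := by
    refine h.le_of_le_middle (hfront (τ - δ)) hq (hfix (τ - δ)) hfq hηP hκ hκ1 hk0 hkP
      ((hp.monotone ?_).trans h1) h2 h3 fun z hz => ?_
    · have := min_le_left 1 (μ / r); linarith
    · have h4 := h.deOp_le_add_mul hp.continuous hp.mem_Icc (by linarith : z - τ ≤ z - (τ - δ))
      rw [hfp] at h4
      have h5 : r * δ ≤ μ := by
        have := min_le_right 1 (μ / r)
        rw [le_div_iff₀ hr0] at this
        linarith
      have h6 := hμle z hz
      have h7 : (r : ℝ) * (z - (τ - δ) - (z - τ)) = r * δ := by ring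
      linarith
  have := csInf_le hbdd hmem
  linarith

end IsCritical

/-! ### Null Lagrangians, integrability and the energy density -/

theorem pow_tangent_le {x c : ℝ} (hx : 0 ≤ x) (hc : 0 ≤ c) (n : ℕ) :
    c ^ n + n * c ^ (n - 1) * (x - c) ≤ x ^ n := by
  have hconv := convexOn_pow (𝕜 := ℝ) n
  rcases lt_trichotomy c x with h | h | h
  · have := hconv.le_slope_of_hasDerivAt hc hx h (hasDerivAt_pow n c)
    rw [slope_def_field, le_div_iff₀ (by linarith)] at this
    linarith
  · simp [h]
  · have := hconv.slope_le_of_hasDerivAt hx hc h (hasDerivAt_pow n c)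
    rw [slope_def_field, div_le_iff₀ (by linarith)] at this
    linarith

/-- Shifting a window average from one factor to the other only costs boundary terms. -/
theorem integral_window_shift {f d : ℝ → ℝ} (hf : Continuous f) (hd : Continuous d) (a b : ℝ) :
    ∫ z in a..b, (f z * (∫ u in (0 : ℝ)..1, d (z + u)) - (∫ u in (0 : ℝ)..1, f (z - u)) * d z)
      = (∫ u in (0 : ℝ)..1, ∫ y in b..(b + u), f (y - u) * d y)
        - ∫ u in (0 : ℝ)..1, ∫ y in a..(a + u), f (y - u) * d y := by
  have hin : ∀ z, f z * (∫ u in (0 : ℝ)..1, d (z + u)) - (∫ u in (0 : ℝ)..1, f (z - u)) * d z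
      = ∫ u in (0 : ℝ)..1, (f z * d (z + u) - f (z - u) * d z) := fun z => by
    have h1 : Continuous fun u => f z * d (z + u) := by fun_prop
    have h2 : Continuous fun u => f (z - u) * d z := by fun_prop
    rw [intervalIntegral.integral_sub (h1.intervalIntegrable 0 1) (h2.intervalIntegrable 0 1),
      intervalIntegral.integral_const_mul, intervalIntegral.integral_mul_const]
  have hcont : Continuous (Function.uncurry fun z u => f z * d (z + u) - f (z - u) * d z) := by
    unfold Function.uncurry; fun_prop
  simp_rw [hin]
  rw [intervalIntegral_intervalIntegral_swap]
  swap
  · exact (hcont.continuousOn.integrableOn_compact (isCompact_uIcc.prod isCompact_uIcc)).mono_set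
      (prod_mono uIoc_subset_uIcc uIoc_subset_uIcc)
  have hc : ∀ c, Continuous fun u => ∫ y in c..(c + u), f (y - u) * d y := fun c => by
    apply intervalIntegral.continuous_parametric_intervalIntegral_of_continuous
    · unfold Function.uncurry; fun_prop
    · fun_prop
  rw [← intervalIntegral.integral_sub ((hc b).intervalIntegrable 0 1)
    ((hc a).intervalIntegrable 0 1)]
  refine intervalIntegral.integral_congr fun u _ => ?_
  have hk : Continuous fun y => f (y - u) * d y := by fun_prop
  have hi : ∀ a b, IntervalIntegrable (fun y => f (y - u) * d y) volume a b :=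
    fun a b => hk.intervalIntegrable a b
  have h1 : Continuous fun z => f z * d (z + u) := by fun_prop
  rw [intervalIntegral.integral_sub (h1.intervalIntegrable a b) (hi a b)]
  have h2 := intervalIntegral.integral_comp_add_right (a := a) (b := b)
    (fun y => f (y - u) * d y) u
  simp only [add_sub_cancel_right] at h2
  rw [h2, intervalIntegral.integral_interval_sub_interval_comm' (hi _ _) (hi _ _) (hi _ _)]

/-- The domain of integration is a triangle of area $1/2$. -/
theorem integral_boundary_mem {k : ℝ → ℝ → ℝ} (hk : Continuous (Function.uncurry k)) {c m M : ℝ}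
    (h : ∀ u ∈ Icc (0 : ℝ) 1, ∀ y ∈ Icc c (c + 1), k u y ∈ Icc m M) :
    (∫ u in (0 : ℝ)..1, ∫ y in c..(c + u), k u y) ∈ Icc (m / 2) (M / 2) := by
  have hcont : Continuous fun u => ∫ y in c..(c + u), k u y := by
    apply intervalIntegral.continuous_parametric_intervalIntegral_of_continuous hk
    fun_prop
  have hin : ∀ u ∈ Icc (0 : ℝ) 1, (∫ y in c..(c + u), k u y) ∈ Icc (u * m) (u * M) := fun u hu => by
    have hku : Continuous (k u) := hk.comp (by fun_prop : Continuous fun y => (u, y))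
    have hy : ∀ y ∈ Icc c (c + u), k u y ∈ Icc m M := fun y hy =>
      h u hu y ⟨hy.1, by linarith [hy.2, hu.2]⟩
    have h1 := intervalIntegral.integral_mono_on (μ := volume) (by linarith [hu.1] : c ≤ c + u)
      (intervalIntegrable_const (c := m)) (hku.intervalIntegrable _ _) fun y h => (hy y h).1
    have h2 := intervalIntegral.integral_mono_on (μ := volume) (by linarith [hu.1] : c ≤ c + u)
      (hku.intervalIntegrable _ _) (intervalIntegrable_const (c := M)) fun y h => (hy y h).2
    simp only [intervalIntegral.integral_const, smul_eq_mul, add_sub_cancel_left] at h1 h2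
    exact ⟨h1, h2⟩
  have e : ∀ x : ℝ, ∫ u in (0 : ℝ)..1, u * x = x / 2 := fun x => by
    rw [intervalIntegral.integral_mul_const, integral_id]; ring
  have hl : ∀ x : ℝ, Continuous fun u : ℝ => u * x := fun x => by fun_prop
  constructor
  · rw [← e m]
    exact intervalIntegral.integral_mono_on zero_le_one ((hl m).intervalIntegrable _ _)
      (hcont.intervalIntegrable _ _) fun u hu => (hin u hu).1
  · rw [← e M]
    exact intervalIntegral.integral_mono_on zero_le_one (hcont.intervalIntegrable _ _)
      ((hl M).intervalIntegrable _ _) fun u hu => (hin u hu).2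

namespace IsFront

variable {P : ℝ} {g : ℝ → ℝ}

theorem integrable_shift_sub (hg : IsFront P g) : Integrable fun z => g (z + 1) - g z := by
  have hc := hg.continuous
  have hcd : Continuous fun z => g (z + 1) - g z := by fun_prop
  refine integrable_of_intervalIntegral_norm_bounded (ι := ℝ) (l := atTop) (a := fun N => -N)
    (b := fun N => N) P (fun N => (hcd.integrableOn_Icc).mono_set Ioc_subset_Icc_self)
    tendsto_neg_atTop_atBot tendsto_id ?_
  filter_upwards with N
  have e : ∀ z, ‖g (z + 1) - g z‖ = g (z + 1) - g z := fun z =>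
    Real.norm_of_nonneg (sub_nonneg.2 (hg.monotone (by linarith)))
  simp_rw [e]
  have hi : ∀ a b, IntervalIntegrable g volume a b := fun a b => hc.intervalIntegrable a b
  rw [intervalIntegral.integral_sub ((hg.comp_add 1).continuous.intervalIntegrable _ _) (hi _ _),
    intervalIntegral.integral_comp_add_right g 1,
    intervalIntegral.integral_interval_sub_interval_comm' (hi _ _) (hi _ _) (hi _ _)]
  have h1 := intervalIntegral.integral_mono_on (μ := volume) (by linarith : N ≤ N + 1)
    (hi _ _) (intervalIntegrable_const (c := P)) fun y _ => (hg.mem_Icc y).2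
  have h2 := intervalIntegral.integral_nonneg (μ := volume) (by linarith : -N ≤ -N + 1)
    fun y _ => (hg.mem_Icc y).1
  simp only [intervalIntegral.integral_const, smul_eq_mul, add_sub_cancel_left, one_mul] at h1
  linarith

theorem windowAvg_mem_Icc (hg : IsFront P g) (z : ℝ) : windowAvg g z ∈ Icc (g z) (g (z + 1)) := by
  have hc := hg.continuous
  exact integral_unit_mem_Icc (by fun_prop) fun u hu =>
    ⟨hg.monotone (by linarith [hu.1]), hg.monotone (by linarith [hu.2])⟩

theorem pow (hg : IsFront P g) {n : ℕ} (hn : n ≠ 0) : IsFront (P ^ n) fun z => g z ^ n :=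
  ⟨hg.continuous.pow n, fun _ _ hab => pow_le_pow_left₀ (hg.mem_Icc _).1 (hg.monotone hab) n,
    by simpa [hn] using hg.tendsto_atBot.pow n, hg.tendsto_atTop.pow n⟩

theorem integrable_windowAvg_sub (hg : IsFront P g) :
    Integrable fun z => windowAvg g z - g z := by
  refine hg.integrable_shift_sub.mono'
    ((continuous_windowAvg hg.continuous).sub hg.continuous).aestronglyMeasurable (ae_of_all _ ?_)
  intro z
  have := hg.windowAvg_mem_Icc z
  rw [Real.norm_of_nonneg (by linarith [this.1])]
  linarith [this.2]

/-- Over $[-N,N]$ only the two boundary triangles of `integral_window_shift` remain, where $g$ tends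
to $P$ and to $0$. The value therefore depends on the limits of the front alone. -/
theorem integral_windowAvg_sub (hg : IsFront P g) : ∫ z, (windowAvg g z - g z) = P / 2 := by
  have hc := hg.continuous
  have h1 := intervalIntegral_tendsto_integral hg.integrable_windowAvg_sub
    tendsto_neg_atTop_atBot (tendsto_id (α := ℝ))
  refine tendsto_nhds_unique h1 ?_
  have e : ∀ N : ℝ, ∫ z in (-N)..N, (windowAvg g z - g z)
      = (∫ u in (0 : ℝ)..1, ∫ y in N..(N + u), g y)
        - ∫ u in (0 : ℝ)..1, ∫ y in (-N)..(-N + u), g y := fun N => by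
    have := integral_window_shift (f := fun _ => 1) continuous_const hc (-N) N
    simpa [windowAvg] using this
  simp only [id, e]
  have hk : Continuous (Function.uncurry fun _ y : ℝ => g y) := by
    unfold Function.uncurry; fun_prop
  have hmem : ∀ c, (∫ u in (0 : ℝ)..1, ∫ y in c..(c + u), g y) ∈ Icc (g c / 2) (g (c + 1) / 2) :=
    fun c => integral_boundary_mem hk fun _ _ y hy => ⟨hg.monotone hy.1, hg.monotone hy.2⟩
  have t1 : Tendsto (fun N => ∫ u in (0 : ℝ)..1, ∫ y in N..(N + u), g y) atTop (𝓝 (P / 2)) :=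
    tendsto_of_tendsto_of_tendsto_of_le_of_le (hg.tendsto_atTop.div_const 2)
      ((hg.comp_add 1).tendsto_atTop.div_const 2) (fun c => (hmem c).1) fun c => (hmem c).2
  have t2 : Tendsto (fun N => ∫ u in (0 : ℝ)..1, ∫ y in N..(N + u), g y) atBot (𝓝 (0 / 2)) :=
    tendsto_of_tendsto_of_tendsto_of_le_of_le (hg.tendsto_atBot.div_const 2)
      ((hg.comp_add 1).tendsto_atBot.div_const 2) (fun c => (hmem c).1) fun c => (hmem c).2
  have := t1.sub (t2.comp tendsto_neg_atTop_atBot)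
  simpa using this

end IsFront

/-- From $g=o(1/|z|)$ and $g\to0$ one gets $|g|\le(1+|z|)^{-1}$ far out, hence $|f|\le
C(1+|z|)^{-(1+\beta)}$. -/
theorem integrable_of_decay {f g : ℝ → ℝ} {C β : ℝ} (hf : Continuous f) (hβ : 0 < β) (hC : 0 ≤ C)
    (hb : Tendsto (fun z => z * g z) atBot (𝓝 0)) (hb0 : Tendsto g atBot (𝓝 0))
    (hfb : ∀ z, |f z| ≤ C * |g z| ^ β * |g z|)
    {g' : ℝ → ℝ} (ht : Tendsto (fun z => z * g' z) atTop (𝓝 0)) (ht0 : Tendsto g' atTop (𝓝 0))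
    (hft : ∀ z, |f z| ≤ C * |g' z| ^ β * |g' z|) : Integrable f := by
  have key : ∀ (F : Filter ℝ) (g : ℝ → ℝ), Tendsto (fun z => z * g z) F (𝓝 0) →
      Tendsto g F (𝓝 0) → (∀ z, |f z| ≤ C * |g z| ^ β * |g z|) →
      f =O[F] fun z : ℝ => (1 + ‖z‖) ^ (-(1 + β)) := by
    intro F g h1 h0 hle
    refine Asymptotics.IsBigO.of_bound C ?_
    have h2 : Tendsto (fun z => |g z| + |z * g z|) F (𝓝 0) := by
      simpa using h0.abs.add h1.abs
    filter_upwards [h2.eventually (gt_mem_nhds one_pos)] with z hz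
    have hpos : 0 < 1 + ‖z‖ := by positivity
    have h3 : |g z| ≤ (1 + ‖z‖)⁻¹ := by
      rw [← one_div, le_div_iff₀ hpos, Real.norm_eq_abs]
      rw [abs_mul] at hz
      nlinarith
    have h4 : (1 + ‖z‖) ^ (-(1 + β)) = ((1 + ‖z‖)⁻¹) ^ β * (1 + ‖z‖)⁻¹ := by
      rw [Real.rpow_neg hpos.le, Real.rpow_add hpos, Real.rpow_one, Real.inv_rpow hpos.le, mul_inv,
        mul_comm]
    rw [h4, Real.norm_eq_abs,
      Real.norm_of_nonneg (show 0 ≤ (1 + ‖z‖)⁻¹ ^ β * (1 + ‖z‖)⁻¹ by positivity)]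
    refine (hle z).trans ?_
    rw [mul_assoc]
    gcongr
  have hint : Integrable fun z : ℝ => (1 + ‖z‖) ^ (-(1 + β)) :=
    integrable_one_add_norm (by simp [hβ])
  exact hf.locallyIntegrable.integrable_of_isBigO_atBot_atTop (key _ _ hb hb0 hfb)
    (hint.integrableAtFilter _) (key _ _ ht ht0 hft) (hint.integrableAtFilter _)

noncomputable section

/-- The coupled potential density, up to a null Lagrangian that makes it nonnegative. -/
def energyDensity (l r : ℕ) (ε : ℝ) (p : ℝ → ℝ) (z : ℝ) : ℝ :=
  singlePotential l r ε (p z) + ε / l * (windowAvg (fun y => p y ^ l) z - windowAvg p z ^ l)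

end

/-- The subtracted term has the same integral for all fronts, so $\mathcal W$ and the energy differ
by a constant. -/
theorem potentialDensity_eq_sub (l r : ℕ) (ε : ℝ) (p : ℝ → ℝ) (z : ℝ) :
    potentialDensity l r ε p z
      = energyDensity l r ε p z - ε / l * (windowAvg (fun y => p y ^ l) z - p z ^ l) := by
  simp only [energyDensity, potentialDensity, singlePotential, windowAvg]
  ring

namespace IsCritical

variable {l r : ℕ} {ε P : ℝ} {p : ℝ → ℝ}

theorem continuous_energyDensity (h : IsCritical l r ε P) (hp : Continuous p) :
    Continuous (energyDensity l r ε p) := by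
  have h1 := continuous_singlePotential h.three_le h.three_le_right ε
  have h2 := continuous_windowAvg hp
  have h3 := continuous_windowAvg (hp.pow l)
  simp only [Pi.pow_def] at h3
  unfold energyDensity
  fun_prop

/-- Jensen's inequality, obtained by averaging the tangent line at the mean. -/
theorem windowAvg_pow_le (hp : Continuous p) (hpm : ∀ y, 0 ≤ p y) (n : ℕ) (z : ℝ) :
    windowAvg p z ^ n ≤ windowAvg (fun y => p y ^ n) z := by
  set c := windowAvg p z with hc
  have hc0 : 0 ≤ c := intervalIntegral.integral_nonneg zero_le_one fun u _ => hpm _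
  have h1 : Continuous fun u => c ^ n + n * c ^ (n - 1) * (p (z + u) - c) := by fun_prop
  have h2 : Continuous fun u => p (z + u) ^ n := by fun_prop
  have h3 : Continuous fun u => p (z + u) := by fun_prop
  have := intervalIntegral.integral_mono_on (μ := volume) zero_le_one (h1.intervalIntegrable 0 1)
    (h2.intervalIntegrable 0 1) fun u _ => pow_tangent_le (hpm (z + u)) hc0 n
  have h4 : Continuous fun u => n * c ^ (n - 1) * (p (z + u) - c) := by fun_prop
  rw [intervalIntegral.integral_add intervalIntegrable_const (h4.intervalIntegrable 0 1),
    intervalIntegral.integral_const_mul,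
    intervalIntegral.integral_sub (h3.intervalIntegrable 0 1) intervalIntegrable_const] at this
  change _ ≤ windowAvg (fun y => p y ^ n) z at this
  rw [show ∫ u in (0 : ℝ)..1, p (z + u) = c from rfl] at this
  simpa using this

theorem singlePotential_le_energyDensity (h : IsCritical l r ε P) (hp : Continuous p)
    (hp0 : ∀ y, 0 ≤ p y) (z : ℝ) :
    singlePotential l r ε (p z) ≤ energyDensity l r ε p z := by
  have h1 := windowAvg_pow_le hp hp0 l z
  have h2 : 0 ≤ ε / l := div_nonneg h.eps_pos.le (Nat.cast_nonneg l)
  have := mul_nonneg h2 (sub_nonneg.2 h1)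
  unfold energyDensity
  linarith

theorem mem_unit (h : IsCritical l r ε P) {x : ℝ} (hx : x ∈ Icc 0 P) : x ∈ Icc (0 : ℝ) 1 :=
  ⟨hx.1, hx.2.trans h.le_one⟩

theorem energyDensity_nonneg (h : IsCritical l r ε P) (hp : Continuous p)
    (hpm : ∀ y, p y ∈ Icc 0 P) (z : ℝ) : 0 ≤ energyDensity l r ε p z :=
  (h.nonneg _ (h.mem_unit (hpm z))).trans
    (h.singlePotential_le_energyDensity hp (fun y => (hpm y).1) z)

theorem integrable_singlePotential (h : IsCritical l r ε P) (hp : p ∈ increasingProfiles P) :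
    Integrable fun z => singlePotential l r ε (p z) := by
  have hf := isFront_of_mem_increasingProfiles hp
  have h0 := hf.tendsto_atTop.sub_const P
  rw [sub_self] at h0
  exact integrable_of_decay (g := p) (g' := fun z => p z - P)
    ((continuous_singlePotential h.three_le h.three_le_right ε).comp hf.continuous)
    (checkInv_exponent_pos h.three_le_right) (Nat.cast_nonneg l) hp.1.2.2.1 hf.tendsto_atBot
    (fun z => h.singlePotential_le_zero (h.mem_unit (hf.mem_Icc z))) hp.1.2.2.2 h0
    fun z => h.singlePotential_le_right (h.mem_unit (hf.mem_Icc z))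

theorem integrable_energyDensity (h : IsCritical l r ε P) (hp : p ∈ increasingProfiles P) :
    Integrable (energyDensity l r ε p) := by
  have hf := isFront_of_mem_increasingProfiles hp
  have hl : l ≠ 0 := by have := h.three_le; omega
  have hg := hf.pow hl
  refine (h.integrable_singlePotential hp).add (Integrable.const_mul ?_ _)
  refine hg.integrable_windowAvg_sub.mono'
    ((continuous_windowAvg hg.continuous).sub
      ((continuous_windowAvg hf.continuous).pow l)).aestronglyMeasurable (ae_of_all _ fun z => ?_)
  have h1 := windowAvg_pow_le hf.continuous (fun y => (hf.mem_Icc y).1) l z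
  have h2 := pow_le_pow_left₀ (hf.mem_Icc z).1 (hf.windowAvg_mem_Icc z).1 l
  rw [Real.norm_of_nonneg (sub_nonneg.2 h1)]
  linarith

theorem integrable_potentialDensity (h : IsCritical l r ε P) (hp : p ∈ increasingProfiles P) :
    Integrable (potentialDensity l r ε p) := by
  have hf := isFront_of_mem_increasingProfiles hp
  have hg := hf.pow (by have := h.three_le; omega : l ≠ 0)
  rw [funext (potentialDensity_eq_sub l r ε p)]
  exact (h.integrable_energyDensity hp).sub (hg.integrable_windowAvg_sub.const_mul _)

theorem potential_eq (h : IsCritical l r ε P) (hp : p ∈ increasingProfiles P) :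
    potential l r ε p = (∫ z, energyDensity l r ε p z) - ε / l * (P ^ l / 2) := by
  have hf := isFront_of_mem_increasingProfiles hp
  have hg := hf.pow (by have := h.three_le; omega : l ≠ 0)
  rw [potential, funext (potentialDensity_eq_sub l r ε p),
    integral_sub (h.integrable_energyDensity hp) (hg.integrable_windowAvg_sub.const_mul _),
    integral_const_mul, hg.integral_windowAvg_sub]

/-! ### Descent of the potential under density evolution -/

/-- One step of the density evolution decreases the potential density by at least a Bregman
divergence, up to a term that integrates to zero. -/
theorem bregman_le_potentialDensity_sub (h : IsCritical l r ε P) (hp : IsFront P p) (z : ℝ) :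
    bregman r (deOp l r ε p z) (p z) + ε * (windowAvg p z ^ (l - 1)
        * (∫ u in (0 : ℝ)..1, (deOp l r ε p (z + u) - p (z + u)))
        - edgeAvg l p z * (deOp l r ε p z - p z))
      ≤ potentialDensity l r ε p z - potentialDensity l r ε (deOp l r ε p) z := by
  have hl := h.three_le
  have hr := h.three_le_right
  have hq := h.deOp_isFront hp
  set q := deOp l r ε p with hqdef
  have hcp := hp.continuous
  have hcq := hq.continuous
  have hwd : ∫ u in (0 : ℝ)..1, (q (z + u) - p (z + u)) = windowAvg q z - windowAvg p z := by
    have h1 : Continuous fun u => q (z + u) := by fun_prop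
    have h2 : Continuous fun u => p (z + u) := by fun_prop
    exact intervalIntegral.integral_sub (h1.intervalIntegrable 0 1) (h2.intervalIntegrable 0 1)
  -- By the choice of $q=Tp$, the linear term in the Bregman divergence is the edge average against
  -- $p-q$. The window power is convex and is bounded below by its tangent at $p$.
  have hcheck : checkInv r (q z) = ε * edgeAvg l p z := by
    rw [checkInv_eq_iff hr (h.mem_unit (hq.mem_Icc z)).2]
    · rfl
    · have hedge := edgeAvg_mem (l := l) hcp le_rfl (z := z) fun y _ => hp.mem_Icc y
      exact (mul_le_mul_of_nonneg_left hedge.2 h.eps_pos.le).trans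
        (h.eps_mul_pow_le h.pos.le le_rfl _)
  have htan := pow_tangent_le (windowAvg_mem hcq hq.mem_Icc z).1
    (windowAvg_mem hcp hp.mem_Icc z).1 l
  have hl0 : (0 : ℝ) < l := by positivity
  have h1 := mul_le_mul_of_nonneg_left htan (div_nonneg h.eps_pos.le hl0.le)
  have e1 : ε / l * (windowAvg p z ^ l + l * windowAvg p z ^ (l - 1)
      * (windowAvg q z - windowAvg p z)) = ε / l * windowAvg p z ^ l
        + ε * (windowAvg p z ^ (l - 1) * (windowAvg q z - windowAvg p z)) := by
    field_simp
  have e2 : ∀ s : ℝ → ℝ, potentialDensity l r ε s z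
      = checkPotential r (s z) - ε / l * windowAvg s z ^ l := fun s => rfl
  rw [hwd, e2, e2, bregman, hcheck]
  linarith

/-- Density evolution decreases the potential. -/
theorem integral_bregman_le (h : IsCritical l r ε P) (hp : p ∈ increasingProfiles P) {M : ℝ}
    (hM : 0 ≤ M) : ∫ z in (-M)..M, bregman r (deOp l r ε p z) (p z)
      ≤ potential l r ε p - potential l r ε (deOp l r ε p) := by
  have hr := h.three_le_right
  have hf := isFront_of_mem_increasingProfiles hp
  have hq := h.deOp_isFront hf
  have hip := h.integrable_potentialDensity hp
  have hiq := h.integrable_potentialDensity (h.deOp_mem_increasingProfiles hp)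
  have hstep := h.bregman_le_potentialDensity_sub hf
  set q := deOp l r ε p with hqdef
  have hcp := hf.continuous
  have hcq := hq.continuous
  have hwp := continuous_windowAvg hcp
  set f : ℝ → ℝ := fun z => windowAvg p z ^ (l - 1)
  set d : ℝ → ℝ := fun z => q z - p z
  have hcf : Continuous f := by fun_prop
  have hcd : Continuous d := by fun_prop
  have hcb : Continuous fun z => bregman r (q z) (p z) :=
    (continuous_bregman hr).comp (hcq.prodMk hcp)
  have hb0 : ∀ z, 0 ≤ bregman r (q z) (p z) := fun z =>
    bregman_nonneg hr (h.mem_unit (hq.mem_Icc z)).2 (h.mem_unit (hf.mem_Icc z)).2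
  have hfm : ∀ z, f z ∈ Icc (0 : ℝ) 1 := fun z => by
    have := windowAvg_mem hcp hf.mem_Icc z
    exact ⟨pow_nonneg this.1 _, pow_le_one₀ this.1 (this.2.trans h.le_one)⟩
  -- The edge average is the reflected window average of `f`, the adjoint of the forward one acting
  -- on `d`. Hence `R` integrates to boundary terms only, and these vanish because $p$ and $Tp$
  -- share their limits.
  set R : ℝ → ℝ := fun z => f z * (∫ u in (0 : ℝ)..1, d (z + u))
    - (∫ u in (0 : ℝ)..1, f (z - u)) * d z with hR
  have hcR : Continuous R := by
    have h1 := continuous_windowAvg hcd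
    have h2 := continuous_edgeAvg l hcp
    exact (hcf.mul h1).sub (h2.mul hcd)
  have hRN : ∀ N : ℝ, |∫ z in (-N)..N, R z| ≤
      ((P - q N) + (P - p N)) / 2 + (q (-N + 1) + p (-N + 1)) / 2 := fun N => by
    have hk : Continuous (Function.uncurry fun u y : ℝ => f (y - u) * d y) := by
      unfold Function.uncurry; fun_prop
    have habs : ∀ u y δ, |d y| ≤ δ → f (y - u) * d y ∈ Icc (-δ) δ := fun u y δ hδ => by
      rw [mem_Icc, ← abs_le, abs_mul, abs_of_nonneg (hfm _).1]
      calc f (y - u) * |d y| ≤ 1 * δ :=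
            mul_le_mul (hfm _).2 hδ (abs_nonneg _) zero_le_one
        _ = δ := one_mul δ
    have h1 := integral_boundary_mem hk (c := N) fun u _ y hy =>
      habs u y ((P - q N) + (P - p N)) (abs_le.2
        ⟨by linarith [hq.monotone hy.1, (hf.mem_Icc y).2, (hq.mem_Icc N).2, (hf.mem_Icc N).2],
         by linarith [hf.monotone hy.1, (hq.mem_Icc y).2, (hq.mem_Icc N).2, (hf.mem_Icc N).2]⟩)
    have h2 := integral_boundary_mem hk (c := -N) fun u _ y hy =>
      habs u y (q (-N + 1) + p (-N + 1)) (abs_le.2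
        ⟨by linarith [hf.monotone hy.2, (hq.mem_Icc y).1, (hq.mem_Icc (-N + 1)).1],
         by linarith [hq.monotone hy.2, (hf.mem_Icc y).1, (hf.mem_Icc (-N + 1)).1]⟩)
    rw [integral_window_shift hcf hcd, abs_le]
    constructor <;> linarith [h1.1, h1.2, h2.1, h2.2]
  have hRlim : Tendsto (fun N : ℝ => ∫ z in (-N)..N, R z) atTop (𝓝 0) := by
    refine squeeze_zero_norm hRN ?_
    have t1 := ((hq.tendsto_atTop.const_sub P).add (hf.tendsto_atTop.const_sub P)).div_const 2
    have t2 := (((hq.comp_add 1).tendsto_atBot.add (hf.comp_add 1).tendsto_atBot).div_const 2).comp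
      tendsto_neg_atTop_atBot
    simpa [Function.comp_def] using t1.add t2
  have hlim := (intervalIntegral_tendsto_integral (hip.sub hiq)
    tendsto_neg_atTop_atBot (tendsto_id (α := ℝ))).sub (hRlim.const_mul ε)
  rw [mul_zero, sub_zero] at hlim
  have hW : ∫ z, (potentialDensity l r ε p - potentialDensity l r ε q) z
      = potential l r ε p - potential l r ε q := integral_sub hip hiq
  rw [hW] at hlim
  refine ge_of_tendsto hlim ?_
  filter_upwards [eventually_ge_atTop M] with N hN
  have h1 : ∫ z in (-M)..M, bregman r (q z) (p z) ≤ ∫ z in (-N)..N, bregman r (q z) (p z) :=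
    intervalIntegral.integral_mono_interval (by linarith) (by linarith) hN
      (ae_of_all _ hb0) (hcb.intervalIntegrable _ _)
  have h2 := intervalIntegral.integral_mono_on (μ := volume) (by linarith : -N ≤ N)
    ((by fun_prop : Continuous fun z => bregman r (q z) (p z) + ε * R z).intervalIntegrable _ _)
    (hip.sub hiq).intervalIntegrable fun z _ => hstep z
  rw [intervalIntegral.integral_add (hcb.intervalIntegrable _ _)
    ((hcR.const_mul ε).intervalIntegrable _ _), intervalIntegral.integral_const_mul] at h2
  simp only [id]
  linarith

end IsCritical

/-! ### Compactness and existence of a minimizer -/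

theorem mem_increasingProfiles_comp_add {P : ℝ} {p : ℝ → ℝ} (hp : p ∈ increasingProfiles P)
    (c : ℝ) : (fun z => p (z + c)) ∈ increasingProfiles P := by
  have hf := isFront_of_mem_increasingProfiles hp
  have hfc := hf.comp_add c
  refine ⟨⟨hfc.continuous, fun z => (hfc.mem_Icc z).1, ?_, ?_⟩, hfc.monotone⟩
  · have := (hp.1.2.2.1.comp (tendsto_atBot_add_const_right _ c tendsto_id)).sub
      (hfc.tendsto_atBot.const_mul c)
    rw [mul_zero, sub_zero] at this
    refine this.congr fun z => ?_
    simp only [Function.comp, id]; ring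
  · have := (hp.1.2.2.2.comp (tendsto_atTop_add_const_right _ c tendsto_id)).sub
      ((hfc.tendsto_atTop.sub_const P).const_mul c)
    rw [sub_self, mul_zero, sub_zero] at this
    refine this.congr fun z => ?_
    simp only [Function.comp, id]; ring

theorem potential_comp_add (l r : ℕ) (ε : ℝ) (p : ℝ → ℝ) (c : ℝ) :
    potential l r ε (fun z => p (z + c)) = potential l r ε p := by
  have e : ∀ z, potentialDensity l r ε (fun z => p (z + c)) z
      = potentialDensity l r ε p (z + c) := fun z => by
    simp only [potentialDensity, show ∀ u, z + u + c = z + c + u from fun u => by ring]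
  unfold potential
  simp_rw [e]
  exact integral_add_right_eq_self (potentialDensity l r ε p) c

theorem increasingProfiles_nonempty {P : ℝ} (hP : 0 ≤ P) : (increasingProfiles P).Nonempty := by
  refine ⟨fun z => P * max 0 (min 1 z), ⟨by fun_prop, fun z => by positivity, ?_, ?_⟩, ?_⟩
  · refine tendsto_const_nhds.congr' ?_
    filter_upwards [eventually_le_atBot 0] with z hz
    rw [max_eq_left ((min_le_right _ _).trans hz)]; ring
  · refine tendsto_const_nhds.congr' ?_
    filter_upwards [eventually_ge_atTop 1] with z hz
    rw [min_eq_left hz, max_eq_right zero_le_one]; ring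
  · intro x y hxy
    exact mul_le_mul_of_nonneg_left (max_le_max le_rfl (min_le_min le_rfl hxy)) hP

theorem IsFront.exists_eq_half {P : ℝ} {p : ℝ → ℝ} (hP : 0 < P) (hp : IsFront P p) :
    ∃ c, p c = P / 2 := by
  obtain ⟨a, ha⟩ := (hp.tendsto_atBot.eventually (gt_mem_nhds (half_pos hP))).exists
  obtain ⟨b, hb⟩ := (hp.tendsto_atTop.eventually (lt_mem_nhds (half_lt_self hP))).exists
  exact mem_range_of_exists_le_of_exists_ge hp.continuous ⟨a, ha.le⟩ ⟨b, hb.le⟩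

/-- A sequence of equi-Lipschitz increasing functions with values in `[0,P]` has a pointwise
convergent subsequence. -/
theorem exists_subseq_tendsto_of_lipschitz {P K : ℝ} (hK : 0 ≤ K) {p : ℕ → ℝ → ℝ}
    (hmem : ∀ n z, p n z ∈ Icc 0 P) (hmono : ∀ n, Monotone (p n))
    (hlip : ∀ n x y, x ≤ y → p n y ≤ p n x + K * (y - x)) :
    ∃ φ : ℕ → ℕ, StrictMono φ ∧ ∃ q : ℝ → ℝ, ∀ z, Tendsto (fun n => p (φ n) z) atTop (𝓝 (q z)) := by
  have hcomp : IsCompact (univ.pi fun _ : ℚ => Icc (0 : ℝ) P) :=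
    isCompact_univ_pi fun _ => isCompact_Icc
  -- Compactness of a countable product gives convergence at all rationals; the common Lipschitz
  -- bound carries it to every real point.
  obtain ⟨g, -, φ, hφ, hg⟩ := hcomp.tendsto_subseq (x := fun n (x : ℚ) => p n x)
    fun n x _ => hmem n x
  have hg' : ∀ x : ℚ, Tendsto (fun n => p (φ n) x) atTop (𝓝 (g x)) := tendsto_pi_nhds.1 hg
  refine ⟨φ, hφ, ?_⟩
  have : ∀ z, ∃ L, Tendsto (fun n => p (φ n) z) atTop (𝓝 L) := by
    intro z
    refine cauchySeq_tendsto_of_complete (Metric.cauchySeq_iff'.2 fun e he => ?_)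
    have hδ : 0 < e / (4 * (K + 1)) := by positivity
    obtain ⟨a, ha, ha'⟩ := exists_rat_btwn (by linarith : z < z + e / (4 * (K + 1)))
    obtain ⟨N, hN⟩ := Metric.cauchySeq_iff'.1 (hg' a).cauchySeq (e / 4) (by positivity)
    have hclose : ∀ n, |p (φ n) z - p (φ n) a| ≤ e / 4 := fun n => by
      have h1 := hmono (φ n) ha.le
      have h2 := hlip (φ n) z a ha.le
      have h3 : K * (a - z) ≤ (K + 1) * (e / (4 * (K + 1))) :=
        mul_le_mul (by linarith) (by linarith) (by linarith) (by linarith)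
      have h4 : (K + 1) * (e / (4 * (K + 1))) = e / 4 := by field_simp
      rw [abs_le]
      constructor <;> linarith
    refine ⟨N, fun n hn => ?_⟩
    have h1 := hN n hn
    rw [Real.dist_eq] at h1 ⊢
    have h2 := abs_le.1 (hclose n)
    have h3 := abs_le.1 (hclose N)
    have h4 := abs_lt.1 h1
    rw [abs_lt]
    constructor <;> linarith
  choose q hq using this
  exact ⟨q, hq⟩

/-- A positive limit would make the integrals grow linearly in $M$. -/
theorem limit_nonpos_of_integral_le {f : ℝ → ℝ} {C a : ℝ} (hf : Continuous f) (hf0 : ∀ z, 0 ≤ f z)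
    (hint : ∀ M : ℝ, 0 ≤ M → ∫ z in (-M)..M, f z ≤ C) (hlim : Tendsto f atTop (𝓝 a)) : a ≤ 0 := by
  by_contra! ha
  obtain ⟨K, hK⟩ := eventually_atTop.1 (hlim.eventually (lt_mem_nhds (half_lt_self ha)))
  have key : ∀ M, max K 0 ≤ M → a / 2 * (M - K) ≤ C := fun M hM => by
    have hMK : K ≤ M := (le_max_left _ _).trans hM
    have hM0 : 0 ≤ M := (le_max_right _ _).trans hM
    have h1 := intervalIntegral.integral_mono_on (μ := volume) hMK
      (intervalIntegrable_const (c := a / 2)) (hf.intervalIntegrable _ _) fun z hz => (hK z hz.1).le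
    simp only [intervalIntegral.integral_const, smul_eq_mul] at h1
    have h2 := hint (max M |K|) (le_max_of_le_left hM0)
    have h3 : ∫ z in K..M, f z ≤ ∫ z in (-(max M |K|))..(max M |K|), f z :=
      intervalIntegral.integral_mono_interval
        (by linarith [le_max_right M |K|, neg_abs_le K]) hMK (le_max_left _ _)
        (ae_of_all _ hf0) (hf.intervalIntegrable _ _)
    linarith
  have := key (max K 0 + |K| + |C| * (2 / a) + 2 / a)
    (by have : 0 ≤ |C| * (2 / a) + 2 / a := by positivity
        linarith [abs_nonneg K])
  have h1 : a / 2 * (|C| * (2 / a) + 2 / a) = |C| + 1 := by field_simp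
  have h2 : 0 ≤ a / 2 * (max K 0 + |K| - K) :=
    mul_nonneg (by linarith) (by linarith [le_max_right K 0, le_abs_self K])
  linarith [le_abs_self C]

theorem tendsto_integral_of_bounded {f : ℕ → ℝ → ℝ} {g : ℝ → ℝ} {B a b : ℝ}
    (hf : ∀ n, Continuous (f n)) (hB : ∀ n z, |f n z| ≤ B)
    (hlim : ∀ z, Tendsto (fun n => f n z) atTop (𝓝 (g z))) :
    Tendsto (fun n => ∫ z in a..b, f n z) atTop (𝓝 (∫ z in a..b, g z)) :=
  intervalIntegral.tendsto_integral_filter_of_dominated_convergence (fun _ => B)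
    (Eventually.of_forall fun n => (hf n).aestronglyMeasurable)
    (Eventually.of_forall fun n => ae_of_all _ fun z _ => hB n z)
    intervalIntegrable_const (ae_of_all _ fun z _ => hlim z)

namespace IsCritical

variable {l r : ℕ} {ε P : ℝ}

theorem tendsto_windowAvg {p : ℕ → ℝ → ℝ} {q : ℝ → ℝ} {B : ℝ} (hp : ∀ n, Continuous (p n))
    (hB : ∀ n z, |p n z| ≤ B) (hlim : ∀ z, Tendsto (fun n => p n z) atTop (𝓝 (q z))) (z : ℝ) :
    Tendsto (fun n => windowAvg (p n) z) atTop (𝓝 (windowAvg q z)) :=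
  tendsto_integral_of_bounded (fun n => (hp n).comp (by fun_prop)) (fun n _ => hB n _)
    fun u => hlim (z + u)

theorem abs_le_one (h : IsCritical l r ε P) {x : ℝ} (hx : x ∈ Icc 0 P) : |x| ≤ 1 :=
  abs_le.2 ⟨by linarith [hx.1], hx.2.trans h.le_one⟩

theorem tendsto_deOp (h : IsCritical l r ε P) {p : ℕ → ℝ → ℝ} {q : ℝ → ℝ}
    (hp : ∀ n, Continuous (p n)) (hmem : ∀ n z, p n z ∈ Icc 0 P)
    (hlim : ∀ z, Tendsto (fun n => p n z) atTop (𝓝 (q z))) (z : ℝ) :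
    Tendsto (fun n => deOp l r ε (p n) z) atTop (𝓝 (deOp l r ε q z)) := by
  have hw := tendsto_windowAvg hp (fun n z => h.abs_le_one (hmem n z)) hlim
  have hedge : Tendsto (fun n => edgeAvg l (p n) z) atTop (𝓝 (edgeAvg l q z)) := by
    refine tendsto_integral_of_bounded (B := 1) (fun n => ?_) (fun n v => ?_)
      fun v => (hw (z - v)).pow (l - 1)
    · have := continuous_windowAvg (hp n)
      fun_prop
    · rw [abs_pow]
      exact pow_le_one₀ (abs_nonneg _) (h.abs_le_one (windowAvg_mem (hp n) (hmem n) _))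
  exact ((hedge.const_mul ε).const_sub 1 |>.pow (r - 1)).const_sub 1

theorem tendsto_energyDensity (h : IsCritical l r ε P) {p : ℕ → ℝ → ℝ} {q : ℝ → ℝ}
    (hp : ∀ n, Continuous (p n)) (hmem : ∀ n z, p n z ∈ Icc 0 P)
    (hlim : ∀ z, Tendsto (fun n => p n z) atTop (𝓝 (q z))) (z : ℝ) :
    Tendsto (fun n => energyDensity l r ε (p n) z) atTop (𝓝 (energyDensity l r ε q z)) := by
  have h1 := tendsto_windowAvg hp (fun n z => h.abs_le_one (hmem n z)) hlim z
  have h2 := tendsto_windowAvg (fun n => (hp n).pow l) (B := 1) (fun n z => by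
    rw [Pi.pow_apply, abs_pow]
    exact pow_le_one₀ (abs_nonneg _) (h.abs_le_one (hmem n z))) (fun z => (hlim z).pow l) z
  have h3 := ((continuous_singlePotential h.three_le h.three_le_right ε).tendsto (q z)).comp
    (hlim z)
  exact h3.add ((h2.sub (h1.pow l)).const_mul (ε / l))

theorem exists_energyDensity_bound (h : IsCritical l r ε P) :
    ∃ B, ∀ p : ℝ → ℝ, Continuous p → (∀ z, p z ∈ Icc 0 P) → ∀ z, |energyDensity l r ε p z| ≤ B := by
  obtain ⟨C, hC⟩ := (isCompact_Icc (a := (0 : ℝ)) (b := P)).exists_bound_of_continuousOn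
    (continuous_singlePotential h.three_le h.three_le_right ε).continuousOn
  refine ⟨C + ε / l * 1, fun p hp hmem z => ?_⟩
  have hl0 : 0 ≤ ε / l := div_nonneg h.eps_pos.le (Nat.cast_nonneg l)
  have h1 := windowAvg_pow_le hp (fun y => (hmem y).1) l z
  have h2 : windowAvg (fun y => p y ^ l) z ≤ 1 := by
    have hu : ∀ u ∈ Icc (0 : ℝ) 1, p (z + u) ^ l ∈ Icc (0 : ℝ) 1 := fun u _ =>
      ⟨pow_nonneg (hmem _).1 _, pow_le_one₀ (hmem _).1 ((hmem _).2.trans h.le_one)⟩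
    exact (integral_unit_mem_Icc (by fun_prop) hu).2
  have h3 := pow_nonneg (windowAvg_mem hp hmem z).1 l
  refine (abs_add_le _ _).trans (add_le_add (hC _ (hmem z)) ?_)
  rw [abs_of_nonneg (mul_nonneg hl0 (sub_nonneg.2 h1))]
  exact mul_le_mul_of_nonneg_left (by linarith) hl0

theorem tendsto_bregman (h : IsCritical l r ε P) {s t : ℕ → ℝ} {a b : ℝ}
    (hs : Tendsto s atTop (𝓝 a)) (ht : Tendsto t atTop (𝓝 b)) :
    Tendsto (fun n => bregman r (s n) (t n)) atTop (𝓝 (bregman r a b)) := by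
  have hp := continuous_checkPotential h.three_le_right
  have hi := continuous_checkInv h.three_le_right
  exact (((hp.tendsto b).comp ht).sub ((hp.tendsto a).comp hs)).sub
    (((hi.tendsto a).comp hs).mul (ht.sub hs))

theorem exists_bregman_bound (h : IsCritical l r ε P) :
    ∃ C, ∀ a ∈ Icc 0 P, ∀ b ∈ Icc 0 P, |bregman r a b| ≤ C := by
  obtain ⟨C, hC⟩ := ((isCompact_Icc (a := (0 : ℝ)) (b := P)).prod
    (isCompact_Icc (a := (0 : ℝ)) (b := P))).exists_bound_of_continuousOn
    (continuous_bregman h.three_le_right).continuousOn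
  exact ⟨C, fun a ha b hb => hC (a, b) ⟨ha, hb⟩⟩

/-- The divergence is continuous and nonnegative, so it vanishes identically, and by strict
convexity it vanishes only where $Tp=p$. -/
theorem deOp_eq_of_integral_bregman_nonpos (h : IsCritical l r ε P) {p : ℝ → ℝ}
    (hp : Continuous p) (hmem : ∀ z, p z ∈ Icc 0 P)
    (hint : ∀ M : ℝ, 0 ≤ M → ∫ z in (-M)..M, bregman r (deOp l r ε p z) (p z) ≤ 0) :
    deOp l r ε p = p := by
  have hr := h.three_le_right
  have hT := h.deOp_mem hp hmem
  have hcb : Continuous fun z => bregman r (deOp l r ε p z) (p z) :=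
    (continuous_bregman hr).comp ((continuous_deOp l r ε hp).prodMk hp)
  funext z
  by_contra hne
  have hpos : 0 < bregman r (deOp l r ε p z) (p z) :=
    bregman_pos hr (h.mem_unit (hT z)).2 (h.mem_unit (hmem z)).2 hne
  have := intervalIntegral.integral_pos (by linarith [abs_nonneg z] : -(|z| + 1) < |z| + 1)
    hcb.continuousOn
    (fun x _ => bregman_nonneg hr (h.mem_unit (hT x)).2 (h.mem_unit (hmem x)).2)
    ⟨z, ⟨by linarith [neg_abs_le z], by linarith [le_abs_self z]⟩, hpos⟩
  linarith [hint (|z| + 1) (by positivity)]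

theorem potential_deOp_le (h : IsCritical l r ε P) {p : ℝ → ℝ} (hp : p ∈ increasingProfiles P) :
    potential l r ε (deOp l r ε p) ≤ potential l r ε p := by
  have := h.integral_bregman_le hp le_rfl
  simp only [neg_zero, intervalIntegral.integral_same] at this
  linarith

theorem fixed_of_minimizer (h : IsCritical l r ε P) {p : ℝ → ℝ}
    (hp : IsMinimizerIn l r ε (increasingProfiles P) p) : deOp l r ε p = p := by
  have hf := isFront_of_mem_increasingProfiles hp.1
  refine h.deOp_eq_of_integral_bregman_nonpos hf.continuous hf.mem_Icc fun M hM => ?_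
  have h1 := h.integral_bregman_le hp.1 hM
  have h2 := hp.2 _ (h.deOp_mem_increasingProfiles hp.1)
  linarith

theorem bddBelow_potential (h : IsCritical l r ε P) :
    BddBelow (potential l r ε '' increasingProfiles P) := by
  refine ⟨-(ε / l * (P ^ l / 2)), ?_⟩
  rintro _ ⟨p, hp, rfl⟩
  have hf := isFront_of_mem_increasingProfiles hp
  have : 0 ≤ ∫ z, energyDensity l r ε p z :=
    integral_nonneg fun z => h.energyDensity_nonneg hf.continuous hf.mem_Icc z
  rw [h.potential_eq hp]
  linarith

/-- A minimizing sequence of pinned, uniformly Lipschitz profiles. -/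
theorem exists_minimizing_seq (h : IsCritical l r ε P) : ∃ p : ℕ → ℝ → ℝ,
    (∀ n, p n ∈ increasingProfiles P) ∧ (∀ n, p n 0 = P / 2) ∧
    (∀ n x y, x ≤ y → p n y ≤ p n x + r * (y - x)) ∧
    Tendsto (fun n => potential l r ε (p n)) atTop
      (𝓝 (sInf (potential l r ε '' increasingProfiles P))) := by
  have hbdd := h.bddBelow_potential
  obtain ⟨u, -, hu, humem⟩ := exists_seq_tendsto_sInf
    ((increasingProfiles_nonempty h.pos.le).image (potential l r ε)) hbdd
  choose q hq hqu using humem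
  -- One application of $T$ costs no potential and gains the slope bound $r$; the translation then
  -- pins the value at the origin.
  have hT : ∀ n, deOp l r ε (q n) ∈ increasingProfiles P := fun n =>
    h.deOp_mem_increasingProfiles (hq n)
  choose c hc using fun n => (isFront_of_mem_increasingProfiles (hT n)).exists_eq_half h.pos
  have hmem : ∀ n, (fun z => deOp l r ε (q n) (z + c n)) ∈ increasingProfiles P := fun n =>
    mem_increasingProfiles_comp_add (hT n) (c n)
  refine ⟨fun n z => deOp l r ε (q n) (z + c n), hmem, fun n => by simpa using hc n,
    fun n x y hxy => ?_, ?_⟩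
  · have hf := isFront_of_mem_increasingProfiles (hq n)
    have := h.deOp_le_add_mul hf.continuous hf.mem_Icc (by linarith : x + c n ≤ y + c n)
    rwa [add_sub_add_right_eq_sub] at this
  · refine tendsto_of_tendsto_of_tendsto_of_le_of_le tendsto_const_nhds hu
      (fun n => csInf_le hbdd ⟨_, hmem n, rfl⟩) fun n => ?_
    simp only
    rw [potential_comp_add, ← hqu n]
    exact h.potential_deOp_le (hq n)

/-- The pinning prevents the limit from being the constant $0$ or $P$, and finite energy excludes
every limit value strictly between them. Minimality passes to the limit because the energy density
is nonnegative: bounds on $[-M,M]$ survive pointwise convergence, and then $M\to\infty$. -/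
theorem exists_minimizer (h : IsCritical l r ε P) :
    ∃ p, IsMinimizerIn l r ε (increasingProfiles P) p ∧ p 0 = P / 2 := by
  have hr := h.three_le_right
  have hP := h.pos
  have hbdd := h.bddBelow_potential
  obtain ⟨p', hS', h0', hlip', hlim'⟩ := h.exists_minimizing_seq
  obtain ⟨φ, hφ, q, hq⟩ := exists_subseq_tendsto_of_lipschitz (Nat.cast_nonneg r)
    (fun n => (isFront_of_mem_increasingProfiles (hS' n)).mem_Icc) (fun n => (hS' n).2) hlip'
  set p : ℕ → ℝ → ℝ := fun n => p' (φ n) with hpdef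
  set m := sInf (potential l r ε '' increasingProfiles P)
  have hS : ∀ n, p n ∈ increasingProfiles P := fun n => hS' _
  have hf : ∀ n, IsFront P (p n) := fun n => isFront_of_mem_increasingProfiles (hS n)
  have hc : ∀ n, Continuous (p n) := fun n => (hf n).continuous
  have hmem : ∀ n z, p n z ∈ Icc 0 P := fun n => (hf n).mem_Icc
  have hW : Tendsto (fun n => potential l r ε (p n)) atTop (𝓝 m) := hlim'.comp hφ.tendsto_atTop
  -- elementary properties of the limit
  have hqmem : ∀ z, q z ∈ Icc 0 P := fun z =>
    isClosed_Icc.mem_of_tendsto (hq z) (Eventually.of_forall fun n => hmem n z)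
  have hqmono : Monotone q := fun x y hxy =>
    le_of_tendsto_of_tendsto' (hq x) (hq y) fun n => (hf n).monotone hxy
  have hqlip : ∀ x y, x ≤ y → q y ≤ q x + r * (y - x) := fun x y hxy =>
    le_of_tendsto_of_tendsto' (hq y) ((hq x).add_const _) fun n => hlip' _ x y hxy
  have hq0 : q 0 = P / 2 :=
    tendsto_nhds_unique (hq 0) (tendsto_const_nhds.congr fun n => (h0' (φ n)).symm)
  have hqc : Continuous q := by
    refine (LipschitzWith.of_dist_le_mul (K := (r : NNReal)) fun x y => ?_).continuous
    rw [Real.dist_eq, Real.dist_eq, NNReal.coe_natCast]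
    rcases le_total x y with hxy | hxy
    · have h1 := hqlip x y hxy
      have h2 := hqmono hxy
      rw [abs_sub_comm, abs_sub_comm x, abs_of_nonneg (by linarith), abs_of_nonneg (by linarith)]
      linarith
    · have h1 := hqlip y x hxy
      have h2 := hqmono hxy
      rw [abs_of_nonneg (by linarith), abs_of_nonneg (by linarith)]
      linarith
  -- the limit is stationary
  have hfix : deOp l r ε q = q := by
    refine h.deOp_eq_of_integral_bregman_nonpos hqc hqmem fun M hM => ?_
    obtain ⟨C, hC⟩ := h.exists_bregman_bound
    have hT := h.tendsto_deOp hc hmem hq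
    have hlim : Tendsto (fun n => ∫ z in (-M)..M, bregman r (deOp l r ε (p n) z) (p n z)) atTop
        (𝓝 (∫ z in (-M)..M, bregman r (deOp l r ε q z) (q z))) := by
      refine tendsto_integral_of_bounded (B := C) (fun n => ?_) (fun n z => ?_) fun z => ?_
      · exact (continuous_bregman hr).comp ((continuous_deOp l r ε (hc n)).prodMk (hc n))
      · exact hC _ (h.deOp_mem (hc n) (hmem n) z) _ (hmem n z)
      · exact h.tendsto_bregman (hT z) (hq z)
    have hW0 := hW.sub_const m
    rw [sub_self] at hW0
    refine le_of_tendsto_of_tendsto' hlim hW0 fun n => ?_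
    have h1 := h.integral_bregman_le (hS n) hM
    have h2 : m ≤ potential l r ε (deOp l r ε (p n)) :=
      csInf_le hbdd ⟨_, h.deOp_mem_increasingProfiles (hS n), rfl⟩
    linarith
  -- the energy of the limit
  have henergy : ∀ M : ℝ, 0 ≤ M →
      ∫ z in (-M)..M, energyDensity l r ε q z ≤ m + ε / l * (P ^ l / 2) := fun M hM => by
    obtain ⟨B, hB⟩ := h.exists_energyDensity_bound
    have hlim : Tendsto (fun n => ∫ z in (-M)..M, energyDensity l r ε (p n) z) atTop
        (𝓝 (∫ z in (-M)..M, energyDensity l r ε q z)) :=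
      tendsto_integral_of_bounded (fun n => h.continuous_energyDensity (hc n))
        (fun n => hB _ (hc n) (hmem n)) (h.tendsto_energyDensity hc hmem hq)
    refine le_of_tendsto_of_tendsto' hlim (hW.add_const (ε / l * (P ^ l / 2))) fun n => ?_
    rw [h.potential_eq (hS n), sub_add_cancel,
      intervalIntegral.integral_of_le (by linarith : -M ≤ M)]
    exact setIntegral_le_integral (h.integrable_energyDensity (hS n))
      (ae_of_all _ (h.energyDensity_nonneg (hc n) (hmem n)))
  have hcs : Continuous fun z => singlePotential l r ε (q z) :=
    (continuous_singlePotential h.three_le hr ε).comp hqc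
  have hs0 : ∀ z, 0 ≤ singlePotential l r ε (q z) := fun z =>
    h.nonneg _ (h.mem_unit (hqmem z))
  have hsingle : ∀ M : ℝ, 0 ≤ M →
      ∫ z in (-M)..M, singlePotential l r ε (q z) ≤ m + ε / l * (P ^ l / 2) := fun M hM =>
    (intervalIntegral.integral_mono_on (μ := volume) (by linarith) (hcs.intervalIntegrable _ _)
      ((h.continuous_energyDensity hqc).intervalIntegrable _ _) fun z _ =>
      h.singlePotential_le_energyDensity hqc (fun y => (hqmem y).1) z).trans (henergy M hM)
  -- the limit connects the two zeros of the potential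
  have hfront : IsFront P q := by
    have hbot := tendsto_atBot_ciInf hqmono ⟨0, by rintro _ ⟨z, rfl⟩; exact (hqmem z).1⟩
    have htop := tendsto_atTop_ciSup hqmono ⟨P, by rintro _ ⟨z, rfl⟩; exact (hqmem z).2⟩
    set a := ⨅ z, q z
    set b := ⨆ z, q z
    have ha0 : 0 ≤ a := ge_of_tendsto' hbot fun z => (hqmem z).1
    have ha1 : a ≤ P / 2 := hq0 ▸ hqmono.le_of_tendsto hbot 0
    have hb0 : P / 2 ≤ b := hq0 ▸ hqmono.ge_of_tendsto htop 0
    have hb1 : b ≤ P := le_of_tendsto' htop fun z => (hqmem z).2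
    have hcsp := continuous_singlePotential h.three_le hr ε
    have ha : a = 0 := by
      by_contra hne
      have hpos := h.singlePotential_pos (lt_of_le_of_ne ha0 (Ne.symm hne)) (by linarith)
      have := limit_nonpos_of_integral_le (f := fun z => singlePotential l r ε (q (-z)))
        (hcs.comp continuous_neg) (fun z => hs0 _) (fun M hM => by
          rw [intervalIntegral.integral_comp_neg (fun z => singlePotential l r ε (q z)), neg_neg]
          exact hsingle M hM)
        ((hcsp.tendsto a).comp (hbot.comp tendsto_neg_atTop_atBot))
      linarith
    have hb : b = P := by
      by_contra hne
      have hpos := h.singlePotential_pos (by linarith) (lt_of_le_of_ne hb1 hne)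
      have := limit_nonpos_of_integral_le hcs hs0 hsingle ((hcsp.tendsto b).comp htop)
      linarith
    exact ⟨hqc, hqmono, ha ▸ hbot, hb ▸ htop⟩
  have hqS := h.mem_increasingProfiles_of_fixed hfront hfix
  refine ⟨q, ⟨hqS, fun s hs => ?_⟩, hq0⟩
  have hle : ∫ z, energyDensity l r ε q z ≤ m + ε / l * (P ^ l / 2) := by
    refine le_of_tendsto (intervalIntegral_tendsto_integral (h.integrable_energyDensity hqS)
      tendsto_neg_atTop_atBot (tendsto_id (α := ℝ))) ?_
    filter_upwards [eventually_ge_atTop 0] with M hM using henergy M hM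
  have hms : m ≤ potential l r ε s := csInf_le hbdd ⟨s, hs, rfl⟩
  rw [h.potential_eq hqS]
  linarith

end IsCritical

theorem corollary1 (l r : ℕ) (hl : 3 ≤ l) (hlr : l ≤ r) :
    -- the functional is well defined on the increasing profiles
    (∀ p ∈ increasingProfiles (pMAP l r),
      MeasureTheory.Integrable (potentialDensity l r (epsMAP l r) p)) ∧
    -- the minimizers
    (∃ p₀ : ℝ → ℝ,
      (∀ q, IsMinimizerIn l r (epsMAP l r) (pinnedProfiles (pMAP l r)) q ↔ q = p₀) ∧
      (∀ q, IsMinimizerIn l r (epsMAP l r) (increasingProfiles (pMAP l r)) q ↔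
        IsTranslate p₀ q)) ∧
    -- the solutions of the density-evolution equation
    (∃ p₁ : ℝ → ℝ,
      (∀ q, (q ∈ pinnedProfiles (pMAP l r) ∧ IsDESolution l r (epsMAP l r) q) ↔ q = p₁) ∧
      (∀ q, (q ∈ increasingProfiles (pMAP l r) ∧ IsDESolution l r (epsMAP l r) q) ↔
        IsTranslate p₁ q)) := by
  have h := isCritical_MAP hl hlr
  set ε := epsMAP l r
  set P := pMAP l r
  obtain ⟨p, hmin, hp0⟩ := h.exists_minimizer
  have hf := isFront_of_mem_increasingProfiles hmin.1
  have hfix := h.fixed_of_minimizer hmin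
  have hsm := h.strictMono_of_fixed hf hfix
  have hpinned : p ∈ pinnedProfiles P := ⟨⟨hmin.1.1, hsm⟩, hp0⟩
  have hsub : pinnedProfiles P ⊆ increasingProfiles P := fun q hq =>
    ⟨hq.1.1, hq.1.2.monotone⟩
  have htrans : ∀ q ∈ increasingProfiles P, deOp l r ε q = q → IsTranslate p q := fun q hq hfq =>
    h.exists_translate hf (isFront_of_mem_increasingProfiles hq) hfix hfq
  have heq : ∀ q ∈ pinnedProfiles P, IsTranslate p q → q = p := by
    rintro q hq ⟨τ, hτ⟩
    have h1 : p (0 - τ) = p 0 := by rw [← hτ, hq.2, hp0]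
    have h2 : τ = 0 := by linarith [hsm.injective h1]
    funext z
    rw [hτ, h2, sub_zero]
  have hDE : ∀ q ∈ increasingProfiles P, (IsDESolution l r ε q ↔ deOp l r ε q = q) := fun q hq =>
    have hqf := isFront_of_mem_increasingProfiles hq
    h.isDESolution_iff hqf.continuous hqf.mem_Icc
  refine ⟨fun q hq => h.integrable_potentialDensity hq, ⟨p, fun q => ⟨fun hq => ?_, ?_⟩,
    fun q => ⟨fun hq => htrans q hq.1 (h.fixed_of_minimizer hq), ?_⟩⟩,
    ⟨p, fun q => ⟨fun hq => ?_, ?_⟩, fun q => ⟨fun hq => ?_, ?_⟩⟩⟩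
  -- A pinned minimizer does at least as well as `p`, which is optimal in the larger class, so it is
  -- optimal there too and hence stationary.
  · have hqS := hsub hq.1
    refine heq q hq.1 (htrans q hqS (h.fixed_of_minimizer ⟨hqS, fun s hs => ?_⟩))
    exact (hq.2 p hpinned).trans (hmin.2 s hs)
  · rintro rfl
    exact ⟨hpinned, fun s hs => hmin.2 s (hsub hs)⟩
  · rintro ⟨τ, hτ⟩
    obtain rfl : q = fun z => p (z + -τ) := funext hτ
    refine ⟨mem_increasingProfiles_comp_add hmin.1 _, fun s hs => ?_⟩
    rw [potential_comp_add]
    exact hmin.2 s hs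
  · exact heq q hq.1 (htrans q (hsub hq.1) ((hDE q (hsub hq.1)).1 hq.2))
  · rintro rfl
    exact ⟨hpinned, (hDE _ hmin.1).2 hfix⟩
  · exact htrans q hq.1 ((hDE q hq.1).1 hq.2)
  · rintro ⟨τ, hτ⟩
    obtain rfl : q = fun z => p (z + -τ) := funext hτ
    have hqS := mem_increasingProfiles_comp_add hmin.1 (-τ)
    exact ⟨hqS, (hDE _ hqS).2 (IsCritical.deOp_comp_add_eq hfix (-τ))⟩
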